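/- Let $K > 1$ and $0 < t < 2$, and put $t' = \frac{2Kt}{2+(K-1)t}$. Then there exist a compact set $E \subset \mathbb{C}$ with $0 < \mathcal{H}^t(E) < \infty$ and a $K$-quasiconformal mapping $\phi : \mathbb{C} \to \mathbb{C}$ such that $0 < \mathcal{H}^{t'}(\phi(E)) < \infty$. Here $\mathcal{H}^s$ denotes $s$-dimensional Hausdorff measure, and a mapping $\phi : \mathbb{C} \to \mathbb{C}$ is called $K$-quasiconformal if it is an orientation preserving homeomorphism of $\mathbb{C}$ onto $\mathbb{C}$ that belongs to the Sobolev space $W^{1,2}_{\mathrm{loc}}(\mathbb{C})$ and satisfies $\max_\alpha |\partial_\alpha \phi| \le K \min_\alpha |\partial_\alpha \phi|$ almost everywhere in $\mathbb{C}$, where $\partial_\alpha$ is the derivative in the direction $e^{i\alpha}$. -/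

import Mathlib

open MeasureTheory
open scoped ContDiff

/-- `G` is a weak (distributional) derivative of `f` on the plane `ℂ = ℝ²`: for almost every `z`,
the real-linear map `G z` plays the role of `Df(z)`, so that `G z (exp (α i))` is the
directional derivative `∂_α f(z)`. Weakness is tested against real test functions `η ∈ C_c^∞`,
in every direction `v`. -/
def HasWeakDerivative (f : ℂ → ℂ) (G : ℂ → ℂ →L[ℝ] ℂ) : Prop :=
  ∀ η : ℂ → ℝ, ContDiff ℝ ∞ η → HasCompactSupport η → ∀ v : ℂ,
    ∫ z, (fderiv ℝ η z v) • f z = - ∫ z, η z • G z v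

/-- `f` belongs to the local Sobolev space `W^{1,2}_loc(ℂ)` and `G` is its weak derivative:
both `f` and `G` are square integrable on compact sets. -/
structure IsSobolevLocWith (f : ℂ → ℂ) (G : ℂ → ℂ →L[ℝ] ℂ) : Prop where
  memLp : ∀ C : Set ℂ, IsCompact C → MemLp f 2 (volume.restrict C)
  memLp_deriv : ∀ C : Set ℂ, IsCompact C → MemLp G 2 (volume.restrict C)
  hasWeakDerivative : HasWeakDerivative f G

/-- A homeomorphism `f` of the plane is orientation preserving if its local degree at every point
is `+1`: as `z` runs once counterclockwise around any circle centred at `c`, the increment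
`f z - f c` winds exactly once counterclockwise around `0`. The winding number is read off from a
continuous logarithm `a` of the loop. -/
def IsOrientationPreserving (f : ℂ → ℂ) : Prop :=
  ∀ (c : ℂ) (r : ℝ), 0 < r → ∃ a : ℝ → ℂ, Continuous a ∧
    (∀ θ : ℝ, Complex.exp (a θ) = f (circleMap c r θ) - f c) ∧
    a (2 * Real.pi) - a 0 = 2 * Real.pi * Complex.I

/-- `f : ℂ → ℂ` is a `K`-quasiconformal mapping of the plane: an orientation preserving
homeomorphism of `ℂ` onto `ℂ`, in `W^{1,2}_loc(ℂ)`, whose directional derivatives satisfy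
`max_α |∂_α f| ≤ K min_β |∂_β f|` almost everywhere. -/
structure IsQuasiconformal (K : ℝ) (f : ℂ → ℂ) : Prop where
  isHomeomorph : IsHomeomorph f
  orientationPreserving : IsOrientationPreserving f
  distortion : ∃ G : ℂ → ℂ →L[ℝ] ℂ, IsSobolevLocWith f G ∧
    ∀ᵐ z : ℂ, ∀ α β : ℝ,
      ‖G z (Complex.exp (α * Complex.I))‖ ≤ K * ‖G z (Complex.exp (β * Complex.I))‖

/-!
Let `α = 2 / t - 1`. Fix packings `P n` of the unit disc by small discs that nearly exhaust its
area, and iterate them: inside each disc of radius `r`, keep a concentric disc shrunk by the factor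
`r ^ α` and put a copy of the next packing into it. A disc of radius `r` thus carries a copy of
ratio `r ^ (1 + α)`, and `(r ^ (1 + α)) ^ t = r ^ 2`, so the masses `∑ r ^ 2 ≈ 1` of the packings
give the resulting Cantor set positive and finite `t`-dimensional measure.

Replacing `α` by `β = α / K` only changes the ratios and turns `t` into `2Kt / (2 + (K - 1)t)`. On
the annulus between a disc and its shrunken copy, the radial stretching `z |z| ^ (1 / K - 1)`
carries the first construction to the second and has distortion `K`; inside the shrunken disc one
recurses with a similarity. The maps obtained after finitely many generations are Lipschitz and
converge uniformly to a homeomorphism matching the two Cantor sets. Distortion `K` bounds their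
energy on a set by `K ^ 2` times the area of its image; as they agree with the limit off sets of
vanishing area, their derivatives converge in `L¹` on compact sets, so the limit is a Sobolev map.
-/

open Metric Set Filter Topology Module
open scoped ENNReal NNReal

section Packing

variable {E : Type*} [NormedAddCommGroup E]

/-- A finite family of non-overlapping balls in the closed unit ball. -/
structure BallPacking (E : Type*) [NormedAddCommGroup E] where
  card : ℕ
  center : Fin card → E
  radius : Fin card → ℝ
  radius_pos : ∀ i, 0 < radius i
  norm_center_add_radius_le : ∀ i, ‖center i‖ + radius i ≤ 1
  radius_add_radius_le : ∀ i j, i ≠ j → radius i + radius j ≤ dist (center i) (center j)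

namespace BallPacking

lemma radius_le_one (P : BallPacking E) (i : Fin P.card) : P.radius i ≤ 1 := by
  linarith [P.norm_center_add_radius_le i, norm_nonneg (P.center i)]

/-- The contraction ratios `r ^ (1 + α)` attached to the balls of a packing. -/
noncomputable def ratio (P : BallPacking E) (α : ℝ) (i : Fin P.card) : ℝ := P.radius i ^ (1 + α)

/-- The fineness condition making all contraction ratios at most half of the radii, so that the
contracted balls are well separated. -/
def Fine (P : BallPacking E) (α : ℝ) : Prop := ∀ i, P.radius i ^ α ≤ 1 / 2

lemma ratio_pos {P : BallPacking E} {α : ℝ} (i : Fin P.card) : 0 < P.ratio α i :=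
  Real.rpow_pos_of_pos (P.radius_pos i) _

lemma ratio_eq_mul {P : BallPacking E} {α : ℝ} (i : Fin P.card) :
    P.ratio α i = P.radius i * P.radius i ^ α := by
  rw [ratio, Real.rpow_add (P.radius_pos i), Real.rpow_one]

lemma Fine.ratio_le {P : BallPacking E} {α : ℝ} (h : P.Fine α) (i : Fin P.card) :
    P.ratio α i ≤ P.radius i / 2 := by
  rw [ratio_eq_mul]
  linarith [mul_le_mul_of_nonneg_left (h i) (P.radius_pos i).le]

lemma Fine.ratio_le_half {P : BallPacking E} {α : ℝ} (h : P.Fine α) (i : Fin P.card) :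
    P.ratio α i ≤ 1 / 2 := by
  linarith [h.ratio_le i, P.radius_le_one i]

variable [NormedSpace ℝ E]

/-- The volume of a packing, as a proportion of the volume of the unit ball. -/
noncomputable def mass (P : BallPacking E) : ℝ := ∑ i, P.radius i ^ finrank ℝ E

lemma mass_nonneg (P : BallPacking E) : 0 ≤ P.mass :=
  Finset.sum_nonneg fun i _ => pow_nonneg (P.radius_pos i).le _

/-- The packing by the balls `closedBall x (r x)` with centers `x ∈ J`. -/
noncomputable def ofFinset (J : Finset E) (r : E → ℝ) (hpos : ∀ x ∈ J, 0 < r x)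
    (hle : ∀ x ∈ J, ‖x‖ + r x ≤ 1) (hdisj : (J : Set E).PairwiseDisjoint fun x =>
      closedBall x (r x)) : BallPacking E where
  card := J.card
  center i := J.equivFin.symm i
  radius i := r (J.equivFin.symm i)
  radius_pos i := hpos _ (J.equivFin.symm i).2
  norm_center_add_radius_le i := hle _ (J.equivFin.symm i).2
  radius_add_radius_le i j hij := by
    have hne : (J.equivFin.symm i : E) ≠ J.equivFin.symm j := fun h =>
      hij (J.equivFin.symm.injective (Subtype.ext h))
    exact ((disjoint_closedBall_closedBall_iff (hpos _ (J.equivFin.symm i).2).le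
      (hpos _ (J.equivFin.symm j).2).le).1
        (hdisj (J.equivFin.symm i).2 (J.equivFin.symm j).2 hne)).le

lemma mass_ofFinset (J : Finset E) (r : E → ℝ) (hpos hle hdisj) :
    (ofFinset J r hpos hle hdisj).mass = ∑ x ∈ J, r x ^ finrank ℝ E := by
  rw [← Finset.sum_coe_sort, ← Equiv.sum_comp J.equivFin.symm]
  rfl

variable [FiniteDimensional ℝ E]

lemma sum_radius_pow_le (P : BallPacking E) {J : Finset (Fin P.card)} {x : E} {ρ : ℝ} (hρ : 0 ≤ ρ)
    (h : ∀ i ∈ J, dist (P.center i) x + P.radius i ≤ ρ) :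
    ∑ i ∈ J, P.radius i ^ finrank ℝ E ≤ ρ ^ finrank ℝ E := by
  borelize E
  let μ : Measure E := Measure.addHaar
  have hdisj : (J : Set (Fin P.card)).PairwiseDisjoint
      fun i => ball (P.center i) (P.radius i) := fun i _ j _ hij =>
    ball_disjoint_ball (P.radius_add_radius_le i j hij)
  have hvol : ∑ i ∈ J, μ (ball (P.center i) (P.radius i)) ≤ μ (closedBall x ρ) := by
    rw [← measure_biUnion_finset hdisj fun _ _ => measurableSet_ball]
    exact measure_mono <| iUnion₂_subset fun i hi =>
      ball_subset_closedBall.trans (closedBall_subset_closedBall' (by linarith [h i hi]))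
  simp only [Measure.addHaar_ball_of_pos μ _ (P.radius_pos _), Measure.addHaar_closedBall μ _ hρ]
    at hvol
  rwa [← Finset.sum_mul, ENNReal.mul_le_mul_iff_left (measure_ball_pos μ 0 one_pos).ne'
    measure_ball_lt_top.ne, ← ENNReal.ofReal_sum_of_nonneg
      fun i _ => pow_nonneg (P.radius_pos i).le _, ENNReal.ofReal_le_ofReal_iff (by positivity)]
    at hvol

lemma mass_le_one (P : BallPacking E) : P.mass ≤ 1 := by
  simpa [mass] using P.sum_radius_pow_le (J := Finset.univ) (x := 0) zero_le_one
    (by simpa using P.norm_center_add_radius_le)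

variable (E) in
lemma exists_closedBalls_covering_unitBall {δ : ℝ} (hδ : 0 < δ) :
    ∃ (s : Set E) (r : E → ℝ), (∀ x ∈ s, 0 < r x ∧ r x ≤ δ ∧ ‖x‖ + r x ≤ 1) ∧
      s.PairwiseDisjoint (fun x => closedBall x (r x)) ∧
      1 ≤ ∑' x : s, ENNReal.ofReal (r x ^ finrank ℝ E) := by
  borelize E
  let μ : Measure E := Measure.addHaar
  obtain ⟨s, r, hs, -, hr, hcov, hdisj⟩ := Besicovitch.exists_disjoint_closedBall_covering_ae
    μ (fun _ => univ) (ball 0 1) (fun x _ d hd => ⟨d / 2, mem_univ _, by simp [hd]⟩)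
    (fun x => min δ (1 - ‖x‖)) (fun x hx => by simpa [hδ] using hx)
  simp only [univ_inter, mem_Ioo, lt_min_iff] at hr
  refine ⟨s, r, fun x hx => ⟨(hr x hx).1, (hr x hx).2.1.le, by linarith [(hr x hx).2.2]⟩,
    hdisj, ?_⟩
  have hle : μ (ball 0 1) ≤ ∑' x : s, μ (closedBall x (r x)) := by
    rw [← measure_biUnion hs hdisj fun _ _ => measurableSet_closedBall]
    exact measure_mono_ae (ae_le_set.2 hcov)
  simp only [Measure.addHaar_closedBall μ _ (hr _ (Subtype.prop _)).1.le] at hle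
  rw [ENNReal.tsum_mul_right] at hle
  exact (ENNReal.mul_le_mul_iff_left (measure_ball_pos μ 0 one_pos).ne'
    measure_ball_lt_top.ne).1 ((one_mul _).trans_le hle)

variable (E) in
theorem exists_mass_ge {η δ : ℝ} (hη : η < 1) (hδ : 0 < δ) :
    ∃ P : BallPacking E, η ≤ P.mass ∧ ∀ i, P.radius i ≤ δ := by
  obtain ⟨s, r, hr, hdisj, hmass⟩ := exists_closedBalls_covering_unitBall E hδ
  obtain ⟨J, hJ⟩ : ∃ J : Finset s,
      ENNReal.ofReal η < ∑ x ∈ J, ENNReal.ofReal (r x ^ finrank ℝ E) :=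
    ((tendsto_order.1 ENNReal.summable.hasSum).1 _
      (((ENNReal.ofReal_lt_one).2 hη).trans_le hmass)).exists
  have hJs : ∀ x ∈ J.map (.subtype s), x ∈ s := fun x hx => Finset.property_of_mem_map_subtype J hx
  refine ⟨ofFinset (J.map (.subtype s)) r (fun x hx => (hr x (hJs x hx)).1)
    (fun x hx => (hr x (hJs x hx)).2.2) (hdisj.subset hJs), ?_, fun i => ?_⟩
  · rw [← ENNReal.ofReal_sum_of_nonneg fun x _ => pow_nonneg (hr x.1 x.2).1.le _] at hJ
    rw [mass_ofFinset, Finset.sum_map]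
    exact (ENNReal.ofReal_lt_ofReal_iff'.1 hJ).1.le
  · exact (hr _ (hJs _ (Finset.coe_mem _))).2.1

end BallPacking

end Packing

section Coding

variable {E : Type*} [NormedAddCommGroup E]

/-- Infinite words selecting a ball in each packing of a sequence. -/
abbrev Code (P : ℕ → BallPacking E) : Type := ∀ k, Fin (P k).card

/-- The scale of the `n`-th generation copy of the unit ball selected by a code. -/
noncomputable def scale (α : ℝ) (P : ℕ → BallPacking E) (w : Code P) (n : ℕ) : ℝ :=
  ∏ k ∈ Finset.range n, (P k).ratio α (w k)

section Scale

variable {α : ℝ} {P : ℕ → BallPacking E}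

lemma scale_pos (w : Code P) (n : ℕ) : 0 < scale α P w n :=
  Finset.prod_pos fun _ _ => BallPacking.ratio_pos _

lemma scale_succ (w : Code P) (n : ℕ) :
    scale α P w (n + 1) = scale α P w n * (P n).ratio α (w n) := Finset.prod_range_succ _ _

lemma scale_succ' (w : Code P) (n : ℕ) :
    scale α P w (n + 1) =
      (P 0).ratio α (w 0) * scale α (fun j => P (j + 1)) (fun j => w (j + 1)) n :=
  (Finset.prod_range_succ' _ _).trans (mul_comm _ _)

lemma scale_congr {w w' : Code P} {n : ℕ} (h : ∀ k < n, w k = w' k) :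
    scale α P w n = scale α P w' n :=
  Finset.prod_congr rfl fun k hk => by rw [h k (Finset.mem_range.1 hk)]

lemma scale_add (w : Code P) (n k : ℕ) :
    scale α P w (n + k) =
      scale α P w n * scale α (fun j => P (n + j)) (fun j => w (n + j)) k :=
  Finset.prod_range_add _ _ _

lemma scale_le (hP : ∀ n, (P n).Fine α) (w : Code P) (n : ℕ) : scale α P w n ≤ (1 / 2) ^ n := by
  simpa [scale] using Finset.prod_le_prod (s := Finset.range n) (g := fun _ => (1 / 2 : ℝ))
    (fun k _ => (BallPacking.ratio_pos (α := α) (w k)).le) (fun k _ => (hP k).ratio_le_half _)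

end Scale

variable [NormedSpace ℝ E]

/-- The point of the Cantor set determined by a code: the common point of the nested balls obtained
from the unit ball by the successive contractions `z ↦ center i + ratio i • z`. -/
noncomputable def codePoint (α : ℝ) (P : ℕ → BallPacking E) (w : Code P) : E :=
  ∑' k, scale α P w k • (P k).center (w k)

/-- The Cantor set of all points determined by codes. -/
def packingCantorSet (α : ℝ) (P : ℕ → BallPacking E) : Set E := range (codePoint α P)

variable {α : ℝ} {P : ℕ → BallPacking E}

lemma norm_scale_smul_center_le (hP : ∀ n, (P n).Fine α) (w : Code P) (k : ℕ) :
    ‖scale α P w k • (P k).center (w k)‖ ≤ scale α P w k - scale α P w (k + 1) := by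
  have hs := scale_pos (α := α) w k
  rw [norm_smul, Real.norm_of_nonneg hs.le, scale_succ, ← mul_one_sub]
  gcongr
  linarith [(P k).norm_center_add_radius_le (w k), (hP k).ratio_le (w k), (P k).radius_pos (w k)]

lemma norm_scale_smul_center_le_pow (hP : ∀ n, (P n).Fine α) (w : Code P) (k : ℕ) :
    ‖scale α P w k • (P k).center (w k)‖ ≤ (1 / 2) ^ k :=
  (norm_scale_smul_center_le hP w k).trans
    (by linarith [scale_pos (α := α) w (k + 1), scale_le hP w k])

variable [CompleteSpace E]

lemma summable_scale_smul_center (hP : ∀ n, (P n).Fine α) (w : Code P) :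
    Summable fun k => scale α P w k • (P k).center (w k) :=
  .of_norm_bounded summable_geometric_two fun k => norm_scale_smul_center_le_pow hP w k

lemma norm_codePoint_le_one (hP : ∀ n, (P n).Fine α) (w : Code P) : ‖codePoint α P w‖ ≤ 1 := by
  refine le_of_tendsto (summable_scale_smul_center hP w).hasSum.tendsto_sum_nat.norm
    (.of_forall fun n => ?_)
  calc ‖∑ k ∈ Finset.range n, scale α P w k • (P k).center (w k)‖
      ≤ ∑ k ∈ Finset.range n, (scale α P w k - scale α P w (k + 1)) :=
        norm_sum_le_of_le _ fun k _ => norm_scale_smul_center_le hP w k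
    _ = 1 - scale α P w n := by rw [Finset.sum_range_sub']; simp [scale]
    _ ≤ 1 := by linarith [scale_pos (α := α) w n]

lemma continuous_codePoint (hP : ∀ n, (P n).Fine α) : Continuous (codePoint α P) := by
  refine continuous_tsum (fun k => ?_) summable_geometric_two
    fun k w => norm_scale_smul_center_le_pow hP w k
  refine (continuous_finsetProd _ fun j _ => ?_).smul ?_
  · exact (continuous_of_discreteTopology (f := (P j).ratio α)).comp (continuous_apply j)
  · exact (continuous_of_discreteTopology (f := (P k).center)).comp (continuous_apply k)

lemma isCompact_packingCantorSet (hP : ∀ n, (P n).Fine α) : IsCompact (packingCantorSet α P) :=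
  isCompact_range (continuous_codePoint hP)

lemma codePoint_eq_sum_add (hP : ∀ n, (P n).Fine α) (w : Code P) (n : ℕ) :
    codePoint α P w = ∑ k ∈ Finset.range n, scale α P w k • (P k).center (w k) +
      scale α P w n • codePoint α (fun j => P (n + j)) (fun j => w (n + j)) := by
  have hs (k : ℕ) : scale α P w (k + n) • (P (k + n)).center (w (k + n)) =
      scale α P w n • scale α (fun j => P (n + j)) (fun j => w (n + j)) k •
        (P (n + k)).center (w (n + k)) := by
    rw [add_comm k n, scale_add, mul_smul]
  rw [codePoint, ← (summable_scale_smul_center hP w).sum_add_tsum_nat_add n, codePoint,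
    ← tsum_const_smul'']
  simp only [hs]

lemma codePoint_eq_add (hP : ∀ n, (P n).Fine α) (w : Code P) :
    codePoint α P w = (P 0).center (w 0) +
      (P 0).ratio α (w 0) • codePoint α (fun j => P (j + 1)) (fun j => w (j + 1)) := by
  rw [codePoint, (summable_scale_smul_center hP w).tsum_eq_zero_add, codePoint, ← tsum_const_smul'']
  simp only [scale_succ', mul_smul]
  simp [scale]

lemma dist_codePoint_of_agree (hP : ∀ n, (P n).Fine α) {w w' : Code P} {n : ℕ}
    (h : ∀ k < n, w k = w' k) :
    dist (codePoint α P w) (codePoint α P w') = scale α P w n *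
      dist (codePoint α (fun j => P (n + j)) (fun j => w (n + j)))
        (codePoint α (fun j => P (n + j)) (fun j => w' (n + j))) := by
  have hsum : ∑ k ∈ Finset.range n, scale α P w k • (P k).center (w k) =
      ∑ k ∈ Finset.range n, scale α P w' k • (P k).center (w' k) :=
    Finset.sum_congr rfl fun k hk => by
      rw [h k (Finset.mem_range.1 hk),
        scale_congr fun j hj => h j (hj.trans (Finset.mem_range.1 hk))]
  rw [codePoint_eq_sum_add hP w n, codePoint_eq_sum_add hP w' n, ← scale_congr h, hsum,
    dist_add_left, dist_smul₀, Real.norm_of_nonneg (scale_pos _ _).le]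

lemma dist_center_codePoint_le (hP : ∀ n, (P n).Fine α) (w : Code P) :
    dist ((P 0).center (w 0)) (codePoint α P w) ≤ (P 0).radius (w 0) / 2 := by
  have hnorm := norm_codePoint_le_one (fun j => hP (j + 1)) (fun j => w (j + 1))
  have hpos := BallPacking.ratio_pos (α := α) (w 0)
  rw [codePoint_eq_add hP, dist_self_add_right, norm_smul, Real.norm_of_nonneg hpos.le]
  exact (mul_le_of_le_one_right hpos.le hnorm).trans ((hP 0).ratio_le (w 0))

lemma radius_add_radius_le_dist_codePoint (hP : ∀ n, (P n).Fine α) {w w' : Code P}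
    (h : w 0 ≠ w' 0) :
    ((P 0).radius (w 0) + (P 0).radius (w' 0)) / 2 ≤
      dist (codePoint α P w) (codePoint α P w') := by
  have hw := dist_center_codePoint_le hP w
  have hw' := dist_center_codePoint_le hP w'
  rw [dist_comm] at hw'
  linarith [(P 0).radius_add_radius_le _ _ h, dist_triangle4 ((P 0).center (w 0))
    (codePoint α P w) (codePoint α P w') ((P 0).center (w' 0))]

end Coding

section Hausdorff

variable {E : Type*} [NormedAddCommGroup E] [NormedSpace ℝ E]

variable (E) in
/-- The exponent `s` for which the `s`-th powers of the ratios `r ^ (1 + α)` are the volumes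
`r ^ finrank ℝ E`; this is the Hausdorff dimension of the Cantor set if almost no volume is lost. -/
noncomputable def cantorDim (α : ℝ) : ℝ := finrank ℝ E / (1 + α)

lemma cantorDim_le_finrank {α : ℝ} (hα : 0 < α) : cantorDim E α ≤ finrank ℝ E :=
  div_le_self (Nat.cast_nonneg _) (by linarith)

lemma cantorDim_nonneg {α : ℝ} (hα : 0 < α) : 0 ≤ cantorDim E α := by
  unfold cantorDim; positivity

lemma cantorDim_pos [FiniteDimensional ℝ E] [Nontrivial E] {α : ℝ} (hα : 0 < α) :
    0 < cantorDim E α :=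
  div_pos (Nat.cast_pos.2 finrank_pos) (by linarith)

lemma BallPacking.ratio_rpow {P : BallPacking E} {α : ℝ} (hα : 0 < α) (i : Fin P.card) :
    P.ratio α i ^ cantorDim E α = P.radius i ^ finrank ℝ E := by
  rw [ratio, cantorDim, ← Real.rpow_mul (P.radius_pos i).le, mul_div_cancel₀ _ (by positivity),
    Real.rpow_natCast]

variable {α : ℝ} {P : ℕ → BallPacking E}

lemma scale_rpow (hα : 0 < α) (w : Code P) (n : ℕ) :
    scale α P w n ^ cantorDim E α = ∏ k ∈ Finset.range n, (P k).radius (w k) ^ finrank ℝ E := by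
  rw [scale, ← Real.finsetProd_rpow _ _ fun _ _ => (BallPacking.ratio_pos _).le]
  exact Finset.prod_congr rfl fun k _ => BallPacking.ratio_rpow hα _

namespace BallPacking

/-- The probability measure on the balls of a packing proportional to volume. -/
noncomputable def weight (Q : BallPacking E) : Measure (Fin Q.card) :=
  ∑ i, ENNReal.ofReal (Q.radius i ^ finrank ℝ E / Q.mass) • Measure.dirac i

variable {Q : BallPacking E}

lemma weight_apply (J : Finset (Fin Q.card)) :
    Q.weight J = ENNReal.ofReal ((∑ i ∈ J, Q.radius i ^ finrank ℝ E) / Q.mass) := by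
  rw [Finset.sum_div, ENNReal.ofReal_sum_of_nonneg fun i _ =>
    div_nonneg (pow_nonneg (Q.radius_pos i).le _) Q.mass_nonneg]
  simp [weight, Measure.finsetSum_apply, Set.indicator_apply, Finset.sum_ite_mem]

lemma isProbabilityMeasure_weight (hQ : 0 < Q.mass) : IsProbabilityMeasure Q.weight := by
  refine ⟨?_⟩
  rw [← Finset.coe_univ, weight_apply, ← mass, div_self hQ.ne', ENNReal.ofReal_one]

end BallPacking

lemma infinitePi_le_prod_image {X : ℕ → Type*} [∀ k, MeasurableSpace (X k)]
    [∀ k, MeasurableSingletonClass (X k)] [∀ k, Countable (X k)] (μ : ∀ k, Measure (X k))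
    [∀ k, IsProbabilityMeasure (μ k)] (A : Set (∀ k, X k)) (n : ℕ) :
    Measure.infinitePi μ A ≤ ∏ k ∈ Finset.range n, μ k ((fun w : ∀ k, X k => w k) '' A) := by
  rw [← Measure.infinitePi_pi μ fun k _ => (Set.to_countable _).measurableSet]
  exact measure_mono fun w hw k _ => mem_image_of_mem _ hw

lemma exists_first_disagreement {X : ℕ → Type*} {A : Set (∀ k, X k)} (hA : A.Nontrivial) :
    ∃ n, (∀ k < n, ∀ w ∈ A, ∀ w' ∈ A, w k = w' k) ∧ ∃ w ∈ A, ∃ w' ∈ A, w n ≠ w' n := by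
  classical
  have h : ∃ n, ∃ w ∈ A, ∃ w' ∈ A, w n ≠ w' n := by
    obtain ⟨w, hw, w', hw', hne⟩ := hA
    obtain ⟨n, hn⟩ := Function.ne_iff.1 hne
    exact ⟨n, w, hw, w', hw', hn⟩
  refine ⟨Nat.find h, fun k hk w hw w' hw' => ?_, Nat.find_spec h⟩
  by_contra hne
  exact Nat.find_min h hk ⟨w, hw, w', hw', hne⟩

lemma mass_pos_of_le_prod {c : ℝ} (hc : 0 < c) (hm : ∀ n, c ≤ ∏ k ∈ Finset.range n, (P k).mass)
    (n : ℕ) : 0 < (P n).mass := by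
  refine (P n).mass_nonneg.lt_of_ne' fun h => ?_
  have := hm (n + 1)
  rw [Finset.prod_range_succ, h, mul_zero] at this
  linarith

lemma prod_weight_image_le (hα : 0 < α) {A : Set (Code P)} {w : Code P} {n : ℕ}
    (hA : ∀ k < n, ∀ w' ∈ A, w' k = w k) :
    ∏ k ∈ Finset.range n, (P k).weight ((fun w : Code P => w k) '' A) ≤
      ENNReal.ofReal (scale α P w n ^ cantorDim E α / ∏ k ∈ Finset.range n, (P k).mass) := by
  rw [scale_rpow hα, ← Finset.prod_div_distrib, ENNReal.ofReal_prod_of_nonneg fun k _ =>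
    div_nonneg (pow_nonneg ((P k).radius_pos _).le _) (P k).mass_nonneg]
  refine Finset.prod_le_prod' fun k hk => ?_
  calc (P k).weight ((fun w : Code P => w k) '' A)
      ≤ (P k).weight ({w k} : Finset (Fin (P k).card)) := by
        refine measure_mono ?_
        rintro _ ⟨w', hw', rfl⟩
        simpa using hA k (Finset.mem_range.1 hk) w' hw'
    _ = _ := by rw [BallPacking.weight_apply, Finset.sum_singleton]

lemma infinitePi_weight_le (hα : 0 < α) (hmass : ∀ n, 0 < (P n).mass) {A : Set (Code P)}
    {w : Code P} {n : ℕ} (hagree : ∀ k < n, ∀ w' ∈ A, w' k = w k) {J : Finset (Fin (P n).card)}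
    (hJ : ∀ w' ∈ A, w' n ∈ J) :
    Measure.infinitePi (fun k => (P k).weight) A ≤
      ENNReal.ofReal (scale α P w n ^ cantorDim E α * (∑ i ∈ J, (P n).radius i ^ finrank ℝ E) /
        ∏ k ∈ Finset.range (n + 1), (P k).mass) := by
  have := fun k => BallPacking.isProbabilityMeasure_weight (hmass k)
  have hs := scale_pos (α := α) w n
  have hprod : 0 ≤ ∏ k ∈ Finset.range n, (P k).mass :=
    Finset.prod_nonneg fun k _ => (hmass k).le
  calc Measure.infinitePi (fun k => (P k).weight) A
      ≤ (∏ k ∈ Finset.range n, (P k).weight ((fun w' : Code P => w' k) '' A)) *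
          (P n).weight ((fun w' : Code P => w' n) '' A) := by
        rw [← Finset.prod_range_succ]
        exact infinitePi_le_prod_image _ _ (n + 1)
    _ ≤ ENNReal.ofReal (scale α P w n ^ cantorDim E α / ∏ k ∈ Finset.range n, (P k).mass) *
          ENNReal.ofReal ((∑ i ∈ J, (P n).radius i ^ finrank ℝ E) / (P n).mass) := by
        rw [← BallPacking.weight_apply]
        exact mul_le_mul' (prod_weight_image_le hα hagree) (measure_mono (image_subset_iff.2 hJ))
    _ = _ := by
        rw [← ENNReal.ofReal_mul (by positivity), div_mul_div_comm, ← Finset.prod_range_succ]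

/-- The part of the Cantor set with a prescribed initial word. -/
def cantorPiece (α : ℝ) (P : ℕ → BallPacking E) (n : ℕ) (v : ∀ k : Fin n, Fin (P k).card) : Set E :=
  codePoint α P '' {w | ∀ k : Fin n, w k = v k}

lemma packingCantorSet_subset_iUnion_cantorPiece (n : ℕ) :
    packingCantorSet α P ⊆ ⋃ v, cantorPiece α P n v := by
  rintro _ ⟨w, rfl⟩
  exact mem_iUnion.2 ⟨fun k => w k, w, fun _ => rfl, rfl⟩

variable [FiniteDimensional ℝ E]

lemma ediam_cantorPiece_le (hP : ∀ n, (P n).Fine α) {n : ℕ} (v : ∀ k : Fin n, Fin (P k).card) :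
    ediam (cantorPiece α P n v) ≤ ENNReal.ofReal (2 * ∏ k : Fin n, (P k).ratio α (v k)) := by
  refine ediam_le ?_
  rintro _ ⟨w, hw, rfl⟩ _ ⟨w', hw', rfl⟩
  have hagree : ∀ k < n, w k = w' k := fun k hk => (hw ⟨k, hk⟩).trans (hw' ⟨k, hk⟩).symm
  have hscale : scale α P w n = ∏ k : Fin n, (P k).ratio α (v k) := by
    rw [scale, Finset.prod_range]
    exact Finset.prod_congr rfl fun k _ => by rw [hw k]
  rw [edist_dist, dist_codePoint_of_agree hP hagree, ← hscale, mul_comm]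
  refine ENNReal.ofReal_le_ofReal (mul_le_mul_of_nonneg_right ?_ (scale_pos _ _).le)
  refine (dist_le_norm_add_norm _ _).trans ?_
  linarith [norm_codePoint_le_one (fun j => hP (n + j)) fun j => w (n + j),
    norm_codePoint_le_one (fun j => hP (n + j)) fun j => w' (n + j)]

lemma ediam_cantorPiece_le_pow (hP : ∀ n, (P n).Fine α) {n : ℕ}
    (v : ∀ k : Fin n, Fin (P k).card) :
    ediam (cantorPiece α P n v) ≤ ENNReal.ofReal (2 * (1 / 2) ^ n) := by
  have hle : ∏ k : Fin n, (P k).ratio α (v k) ≤ (1 / 2) ^ n := by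
    simpa using Finset.prod_le_prod (s := Finset.univ) (g := fun _ : Fin n => (1 / 2 : ℝ))
      (fun k _ => (BallPacking.ratio_pos (α := α) (v k)).le) (fun k _ => (hP k).ratio_le_half _)
  exact (ediam_cantorPiece_le hP v).trans (ENNReal.ofReal_le_ofReal (by linarith))

lemma sum_ediam_cantorPiece_rpow_le (hα : 0 < α) (hP : ∀ n, (P n).Fine α) (n : ℕ) :
    ∑ v, ediam (cantorPiece α P n v) ^ cantorDim E α ≤ ENNReal.ofReal (2 ^ cantorDim E α) := by
  have hpos (v : ∀ k : Fin n, Fin (P k).card) : 0 ≤ ∏ k : Fin n, (P k).ratio α (v k) :=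
    Finset.prod_nonneg fun _ _ => (BallPacking.ratio_pos _).le
  have hterm (v : ∀ k : Fin n, Fin (P k).card) : ediam (cantorPiece α P n v) ^ cantorDim E α ≤
      ENNReal.ofReal (2 ^ cantorDim E α * ∏ k : Fin n, (P k).radius (v k) ^ finrank ℝ E) := by
    refine (ENNReal.rpow_le_rpow (ediam_cantorPiece_le hP v) (cantorDim_nonneg hα)).trans_eq ?_
    rw [ENNReal.ofReal_rpow_of_nonneg (mul_nonneg zero_le_two (hpos v)) (cantorDim_nonneg hα),
      Real.mul_rpow zero_le_two (hpos v),
      ← Real.finsetProd_rpow _ _ fun _ _ => (BallPacking.ratio_pos _).le]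
    simp only [BallPacking.ratio_rpow hα]
  have hradius (v : ∀ k : Fin n, Fin (P k).card) :
      0 ≤ ∏ k : Fin n, (P k).radius (v k) ^ finrank ℝ E :=
    Finset.prod_nonneg fun k _ => pow_nonneg ((P k).radius_pos _).le _
  calc ∑ v, ediam (cantorPiece α P n v) ^ cantorDim E α
      ≤ ∑ v : ∀ k : Fin n, Fin (P k).card,
          ENNReal.ofReal (2 ^ cantorDim E α * ∏ k : Fin n, (P k).radius (v k) ^ finrank ℝ E) :=
        Finset.sum_le_sum fun v _ => hterm v
    _ = ENNReal.ofReal (2 ^ cantorDim E α * ∏ k : Fin n, (P k).mass) := by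
        rw [← ENNReal.ofReal_sum_of_nonneg fun v _ => mul_nonneg (by positivity) (hradius v),
          ← Finset.mul_sum]
        simp only [BallPacking.mass, Finset.prod_univ_sum, Fintype.piFinset_univ]
    _ ≤ ENNReal.ofReal (2 ^ cantorDim E α) :=
        ENNReal.ofReal_le_ofReal <| mul_le_of_le_one_right (by positivity) <|
          Finset.prod_le_one (fun k _ => (P k).mass_nonneg) fun k _ => (P k).mass_le_one

theorem hausdorffMeasure_packingCantorSet_lt_top [MeasurableSpace E] [BorelSpace E] (hα : 0 < α)
    (hP : ∀ n, (P n).Fine α) : μH[cantorDim E α] (packingCantorSet α P) < ⊤ := by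
  have hlim : Tendsto (fun n : ℕ => ENNReal.ofReal (2 * (1 / 2) ^ n)) atTop (𝓝 0) := by
    simpa using ENNReal.tendsto_ofReal ((tendsto_pow_atTop_nhds_zero_of_lt_one
      (r := (1 / 2 : ℝ)) (by norm_num) (by norm_num)).const_mul 2)
  calc μH[cantorDim E α] (packingCantorSet α P)
      ≤ liminf (fun n => ∑ v, ediam (cantorPiece α P n v) ^ cantorDim E α) atTop :=
        Measure.hausdorffMeasure_le_liminf_sum _ _ _ hlim (cantorPiece α P)
          (.of_forall fun _ => ediam_cantorPiece_le_pow hP)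
          (.of_forall packingCantorSet_subset_iUnion_cantorPiece)
    _ ≤ liminf (fun _ : ℕ => ENNReal.ofReal (2 ^ cantorDim E α)) atTop :=
        liminf_le_liminf (.of_forall (sum_ediam_cantorPiece_rpow_le hα hP))
    _ = ENNReal.ofReal (2 ^ cantorDim E α) := liminf_const _
    _ < ⊤ := ENNReal.ofReal_lt_top

lemma radius_le_of_dist_codePoint_le (hP : ∀ n, (P n).Fine α) {A : Set (Code P)} {D : ℝ}
    (hdist : ∀ w ∈ A, ∀ w' ∈ A, dist (codePoint α P w) (codePoint α P w') ≤ D)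
    (hne : ∃ w ∈ A, ∃ w' ∈ A, w 0 ≠ w' 0) {w : Code P} (hw : w ∈ A) :
    (P 0).radius (w 0) ≤ 2 * D := by
  obtain ⟨w', hw', h⟩ : ∃ w' ∈ A, w 0 ≠ w' 0 := by
    obtain ⟨v, hv, v', hv', h⟩ := hne
    by_cases hwv : w 0 = v 0
    exacts [⟨v', hv', hwv ▸ h⟩, ⟨v, hv, hwv⟩]
  linarith [radius_add_radius_le_dist_codePoint hP h, hdist w hw w' hw', (P 0).radius_pos (w' 0)]

lemma sum_radius_pow_le_of_dist_codePoint_le (hα : 0 < α) (hP : ∀ n, (P n).Fine α)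
    {A : Set (Code P)} {D : ℝ}
    (hdist : ∀ w ∈ A, ∀ w' ∈ A, dist (codePoint α P w) (codePoint α P w') ≤ D)
    (hne : ∃ w ∈ A, ∃ w' ∈ A, w 0 ≠ w' 0) {J : Finset (Fin (P 0).card)}
    (hJ : ∀ i ∈ J, ∃ w ∈ A, w 0 = i) :
    ∑ i ∈ J, (P 0).radius i ^ finrank ℝ E ≤ 5 ^ finrank ℝ E * D ^ cantorDim E α := by
  have hradius : ∀ w ∈ A, (P 0).radius (w 0) ≤ 2 * D := fun w hw =>
    radius_le_of_dist_codePoint_le hP hdist hne hw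
  obtain ⟨v, hv, -⟩ := hne
  have hD : 0 < D := by linarith [hradius v hv, (P 0).radius_pos (v 0)]
  rcases le_or_gt D 1 with h | h
  · calc ∑ i ∈ J, (P 0).radius i ^ finrank ℝ E
        ≤ (5 * D) ^ finrank ℝ E := by
          refine (P 0).sum_radius_pow_le (x := codePoint α P v) (by positivity) fun i hi => ?_
          obtain ⟨w, hw, rfl⟩ := hJ i hi
          linarith [dist_triangle ((P 0).center (w 0)) (codePoint α P w) (codePoint α P v),
            dist_center_codePoint_le hP w, hdist w hw v hv, hradius w hw]
      _ = 5 ^ finrank ℝ E * D ^ (finrank ℝ E : ℝ) := by rw [mul_pow, Real.rpow_natCast]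
      _ ≤ 5 ^ finrank ℝ E * D ^ cantorDim E α := by
          gcongr 5 ^ finrank ℝ E * ?_
          exact Real.rpow_le_rpow_of_exponent_ge hD h (cantorDim_le_finrank hα)
  · calc ∑ i ∈ J, (P 0).radius i ^ finrank ℝ E
        ≤ (P 0).mass := Finset.sum_le_sum_of_subset_of_nonneg (Finset.subset_univ J)
          fun i _ _ => pow_nonneg ((P 0).radius_pos i).le _
      _ ≤ 1 := (P 0).mass_le_one
      _ ≤ 5 ^ finrank ℝ E * D ^ cantorDim E α :=
          one_le_mul_of_one_le_of_one_le (one_le_pow₀ (by norm_num))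
            (Real.one_le_rpow h.le (cantorDim_nonneg hα))

lemma sum_radius_pow_le_of_agree (hα : 0 < α) (hP : ∀ n, (P n).Fine α) {A : Set (Code P)} {D : ℝ}
    (hdist : ∀ w ∈ A, ∀ w' ∈ A, dist (codePoint α P w) (codePoint α P w') ≤ D) {n : ℕ}
    {v : Code P} (hagree : ∀ k < n, ∀ w ∈ A, w k = v k) (hne : ∃ w ∈ A, ∃ w' ∈ A, w n ≠ w' n)
    {J : Finset (Fin (P n).card)} (hJ : ∀ i ∈ J, ∃ w ∈ A, w n = i) :
    ∑ i ∈ J, (P n).radius i ^ finrank ℝ E ≤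
      5 ^ finrank ℝ E * (D / scale α P v n) ^ cantorDim E α := by
  refine sum_radius_pow_le_of_dist_codePoint_le (P := fun j => P (n + j)) hα (fun j => hP (n + j))
    (A := (fun w : Code P => fun j => w (n + j)) '' A) ?_ ?_ fun i hi => ?_
  · rintro _ ⟨w, hw, rfl⟩ _ ⟨w', hw', rfl⟩
    have hww' : ∀ k < n, w k = w' k := fun k hk => by rw [hagree k hk w hw, hagree k hk w' hw']
    rw [le_div_iff₀ (scale_pos _ _), mul_comm, ← scale_congr fun k hk => hagree k hk w hw,
      ← dist_codePoint_of_agree hP hww']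
    exact hdist w hw w' hw'
  · obtain ⟨w, hw, w', hw', h⟩ := hne
    exact ⟨_, ⟨w, hw, rfl⟩, _, ⟨w', hw', rfl⟩, h⟩
  · obtain ⟨w, hw, rfl⟩ := hJ i hi
    exact ⟨_, ⟨w, hw, rfl⟩, rfl⟩

section Frostman

variable {c : ℝ}

lemma infinitePi_weight_singleton [Nontrivial E] (hα : 0 < α) (hP : ∀ n, (P n).Fine α)
    (hc : 0 < c) (hm : ∀ n, c ≤ ∏ k ∈ Finset.range n, (P k).mass) (w : Code P) :
    Measure.infinitePi (fun k => (P k).weight) {w} = 0 := by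
  have := fun k => BallPacking.isProbabilityMeasure_weight (mass_pos_of_le_prod hc hm k)
  set s := cantorDim E α
  have hspos : 0 < s := cantorDim_pos hα
  have hlim : Tendsto (fun n : ℕ => ENNReal.ofReal (((1 / 2) ^ s) ^ n / c)) atTop (𝓝 0) := by
    have h := tendsto_pow_atTop_nhds_zero_of_lt_one (r := (1 / 2 : ℝ) ^ s) (by positivity)
      (Real.rpow_lt_one (by norm_num) (by norm_num) hspos)
    simpa using ENNReal.tendsto_ofReal (h.div_const c)
  refine le_antisymm (ge_of_tendsto' hlim fun n => ?_) zero_le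
  calc Measure.infinitePi (fun k => (P k).weight) {w}
      ≤ ENNReal.ofReal (scale α P w n ^ s / ∏ k ∈ Finset.range n, (P k).mass) :=
        (infinitePi_le_prod_image _ _ n).trans
          (prod_weight_image_le hα fun k _ w' hw' => congrFun hw' k)
    _ ≤ ENNReal.ofReal (((1 / 2) ^ n) ^ s / c) := ENNReal.ofReal_le_ofReal <|
        div_le_div₀ (by positivity) (Real.rpow_le_rpow (scale_pos w n).le (scale_le hP w n)
          hspos.le) hc (hm n)
    _ = ENNReal.ofReal (((1 / 2) ^ s) ^ n / c) := by
        rw [← Real.rpow_natCast, ← Real.rpow_mul (by norm_num), mul_comm,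
          Real.rpow_mul (by norm_num), Real.rpow_natCast]

lemma infinitePi_weight_preimage_le [Nontrivial E] (hα : 0 < α) (hP : ∀ n, (P n).Fine α)
    (hc : 0 < c) (hm : ∀ n, c ≤ ∏ k ∈ Finset.range n, (P k).mass) {U : Set E}
    (hU : Bornology.IsBounded U) :
    Measure.infinitePi (fun k => (P k).weight) (codePoint α P ⁻¹' U) ≤
      ENNReal.ofReal (5 ^ finrank ℝ E / c * diam U ^ cantorDim E α) := by
  have := fun k => BallPacking.isProbabilityMeasure_weight (mass_pos_of_le_prod hc hm k)
  set A := codePoint α P ⁻¹' U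
  rcases A.subsingleton_or_nontrivial with hA | hA
  · rcases hA.eq_empty_or_singleton with h | ⟨w, h⟩
    · simp [h]
    · rw [h, infinitePi_weight_singleton hα hP hc hm]
      exact zero_le
  classical
  obtain ⟨n, hagree, hne⟩ := exists_first_disagreement hA
  obtain ⟨v, hv, -⟩ := id hne
  have hagree' : ∀ k < n, ∀ w ∈ A, w k = v k := fun k hk w hw => hagree k hk w hw v hv
  let J : Finset (Fin (P n).card) := {i | ∃ w ∈ A, w n = i}
  have hsum := sum_radius_pow_le_of_agree hα hP
    (fun w hw w' hw' => dist_le_diam_of_mem hU hw hw') hagree' hne (J := J)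
    fun i hi => (Finset.mem_filter.1 hi).2
  have hs := scale_pos (α := α) v n
  calc Measure.infinitePi (fun k => (P k).weight) A
      ≤ ENNReal.ofReal (scale α P v n ^ cantorDim E α *
          (∑ i ∈ J, (P n).radius i ^ finrank ℝ E) / ∏ k ∈ Finset.range (n + 1), (P k).mass) :=
        infinitePi_weight_le hα (mass_pos_of_le_prod hc hm) hagree' fun w hw =>
          Finset.mem_filter.2 ⟨Finset.mem_univ _, w, hw, rfl⟩
    _ ≤ ENNReal.ofReal (scale α P v n ^ cantorDim E α *
          (5 ^ finrank ℝ E * (diam U / scale α P v n) ^ cantorDim E α) / c) :=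
        ENNReal.ofReal_le_ofReal (div_le_div₀ (by positivity) (by gcongr) hc (hm _))
    _ = ENNReal.ofReal (5 ^ finrank ℝ E / c * diam U ^ cantorDim E α) := by
        rw [Real.div_rpow diam_nonneg hs.le]
        field_simp

theorem hausdorffMeasure_packingCantorSet_pos [Nontrivial E] [MeasurableSpace E] [BorelSpace E]
    (hα : 0 < α) (hP : ∀ n, (P n).Fine α) (hc : 0 < c)
    (hm : ∀ n, c ≤ ∏ k ∈ Finset.range n, (P k).mass) :
    0 < μH[cantorDim E α] (packingCantorSet α P) := by
  have := fun k => BallPacking.isProbabilityMeasure_weight (mass_pos_of_le_prod hc hm k)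
  have hmeas : Measurable (codePoint α P) := (continuous_codePoint hP).measurable
  let ν := (Measure.infinitePi fun k => (P k).weight).map (codePoint α P)
  let C := ENNReal.ofReal (5 ^ finrank ℝ E / c)
  have hfrostman (U : Set E) (hU : Bornology.IsBounded U) : ν U ≤ C * ediam U ^ cantorDim E α := by
    calc ν U ≤ ν (closure U) := measure_mono subset_closure
      _ ≤ ENNReal.ofReal (5 ^ finrank ℝ E / c * diam (closure U) ^ cantorDim E α) := by
        rw [Measure.map_apply hmeas isClosed_closure.measurableSet]
        exact infinitePi_weight_preimage_le hα hP hc hm hU.closure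
      _ = C * ediam U ^ cantorDim E α := by
        rw [diam_closure, ENNReal.ofReal_mul (by positivity), ← ENNReal.ofReal_rpow_of_nonneg
          diam_nonneg (cantorDim_nonneg hα), diam, ENNReal.ofReal_toReal hU.ediam_ne_top]
  have hle : C⁻¹ • ν ≤ μH[cantorDim E α] :=
    Measure.le_hausdorffMeasure _ _ 1 one_pos fun U hU => by
      rw [Measure.smul_apply, smul_eq_mul, ← ENNReal.div_eq_inv_mul]
      exact ENNReal.div_le_of_le_mul' (hfrostman U
        (isBounded_iff_ediam_ne_top.2 (hU.trans_lt ENNReal.one_lt_top).ne))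
  have hν : ν (packingCantorSet α P) = 1 := by
    rw [Measure.map_apply hmeas (isCompact_packingCantorSet hP).measurableSet, packingCantorSet,
      preimage_range, measure_univ]
  calc 0 < C⁻¹ := ENNReal.inv_pos.2 ENNReal.ofReal_ne_top
    _ = (C⁻¹ • ν) (packingCantorSet α P) := by rw [Measure.smul_apply, hν, smul_eq_mul, mul_one]
    _ ≤ μH[cantorDim E α] (packingCantorSet α P) := hle _

end Frostman

end Hausdorff

section Stretch

variable {E : Type*} [NormedAddCommGroup E] {f g : E → E}

/-- A Lipschitz map that is the identity off the open unit ball and preserves the closed unit ball: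
the building block of maps acting independently on the balls of a packing. -/
structure IsBallMap (f : E → E) : Prop where
  eq_self : ∀ z, 1 ≤ ‖z‖ → f z = z
  norm_le : ∀ z, ‖z‖ ≤ 1 → ‖f z‖ ≤ 1
  lipschitz : ∃ C : ℝ≥0, LipschitzWith C f

lemma isBallMap_id : IsBallMap (id : E → E) where
  eq_self _ _ := rfl
  norm_le _ h := h
  lipschitz := ⟨1, LipschitzWith.id⟩

lemma IsBallMap.continuous (hf : IsBallMap f) : Continuous f :=
  hf.lipschitz.elim fun _ h => h.continuous

lemma IsBallMap.dist_le_two {f g : E → E} (hf : IsBallMap f) (hg : IsBallMap g) (z : E) :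
    dist (f z) (g z) ≤ 2 := by
  rcases le_total ‖z‖ 1 with h | h
  · linarith [dist_le_norm_add_norm (f z) (g z), hf.norm_le z h, hg.norm_le z h]
  · rw [hf.eq_self z h, hg.eq_self z h, dist_self]
    exact zero_le_two

variable [NormedSpace ℝ E]

lemma lipschitzWith_radial {c : ℝ → ℝ} {B L R : ℝ≥0} (hB : ∀ r, ‖c r‖ ≤ B)
    (hL : LipschitzWith L c) (hR : ∀ r : ℝ, R ≤ r → c r = c R) :
    LipschitzWith (B + L * R) fun z : E => c ‖z‖ • z := by
  have key : ∀ z w : E, ‖z‖ ≤ ‖w‖ → ‖c ‖z‖ • z - c ‖w‖ • w‖ ≤ (B + L * R) * ‖z - w‖ := by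
    intro z w hzw
    have hcoeff : ‖c ‖z‖ - c ‖w‖‖ * ‖z‖ ≤ L * R * ‖z - w‖ := by
      rcases le_total ‖z‖ R with h | h
      · calc ‖c ‖z‖ - c ‖w‖‖ * ‖z‖ ≤ L * ‖‖z‖ - ‖w‖‖ * R := by gcongr; exact hL.norm_sub_le _ _
          _ ≤ L * ‖z - w‖ * R := by gcongr; exact abs_norm_sub_norm_le z w
          _ = L * R * ‖z - w‖ := by ring
      · rw [hR _ h, hR _ (h.trans hzw), sub_self, norm_zero, zero_mul]
        positivity
    calc ‖c ‖z‖ • z - c ‖w‖ • w‖ = ‖c ‖w‖ • (z - w) + (c ‖z‖ - c ‖w‖) • z‖ := by congr 1; module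
      _ ≤ ‖c ‖w‖‖ * ‖z - w‖ + ‖c ‖z‖ - c ‖w‖‖ * ‖z‖ := by
        simpa only [norm_smul] using norm_add_le (c ‖w‖ • (z - w)) ((c ‖z‖ - c ‖w‖) • z)
      _ ≤ B * ‖z - w‖ + L * R * ‖z - w‖ := by gcongr; exact hB _
      _ = (B + L * R) * ‖z - w‖ := by ring
  refine LipschitzWith.of_dist_le_mul fun z w => ?_
  push_cast
  rcases le_total ‖z‖ ‖w‖ with h | h
  · rw [dist_eq_norm, dist_eq_norm]
    exact key z w h
  · rw [dist_comm, dist_comm z, dist_eq_norm, dist_eq_norm]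
    exact key w z h

/-- The radial map `z ↦ ‖z‖ ^ (p - 1) • z` on the annulus `a ≤ ‖z‖ ≤ 1`, extended by the identity
outside and linearly inside. -/
noncomputable def stretch (a p : ℝ) (z : E) : E := max a (min 1 ‖z‖) ^ (p - 1) • z

variable {a p : ℝ}

lemma stretch_of_le (ha1 : a ≤ 1) {z : E} (hz : ‖z‖ ≤ a) : stretch a p z = a ^ (p - 1) • z := by
  rw [stretch, min_eq_right (hz.trans ha1), max_eq_left hz]

lemma stretch_of_one_le (ha1 : a ≤ 1) {z : E} (hz : 1 ≤ ‖z‖) : stretch a p z = z := by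
  rw [stretch, min_eq_left hz, max_eq_right ha1, Real.one_rpow, one_smul]

lemma stretch_of_mem {z : E} (hz : a ≤ ‖z‖) (hz1 : ‖z‖ ≤ 1) :
    stretch a p z = ‖z‖ ^ (p - 1) • z := by
  rw [stretch, min_eq_right hz1, max_eq_right hz]

lemma norm_stretch_of_mem (ha0 : 0 < a) {z : E} (hz : a ≤ ‖z‖) (hz1 : ‖z‖ ≤ 1) :
    ‖stretch a p z‖ = ‖z‖ ^ p := by
  have h0 : 0 < ‖z‖ := ha0.trans_le hz
  rw [stretch_of_mem hz hz1, norm_smul, Real.norm_of_nonneg (by positivity),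
    Real.rpow_sub_one h0.ne', div_mul_cancel₀ _ h0.ne']

lemma norm_stretch_of_le (ha0 : 0 < a) (ha1 : a ≤ 1) {z : E} (hz : ‖z‖ ≤ a) :
    ‖stretch a p z‖ ≤ a ^ p := by
  rw [stretch_of_le ha1 hz, norm_smul, Real.norm_of_nonneg (by positivity),
    Real.rpow_sub_one ha0.ne', div_mul_eq_mul_div, div_le_iff₀ ha0]
  gcongr

lemma norm_stretch_le_one (ha0 : 0 < a) (ha1 : a ≤ 1) (hp : 0 < p) {z : E} (hz : ‖z‖ ≤ 1) :
    ‖stretch a p z‖ ≤ 1 := by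
  rcases le_total ‖z‖ a with h | h
  · exact (norm_stretch_of_le ha0 ha1 h).trans (Real.rpow_le_one ha0.le ha1 hp.le)
  · rw [norm_stretch_of_mem ha0 h hz]
    exact Real.rpow_le_one (norm_nonneg _) hz hp.le

lemma rpow_le_norm_stretch (ha0 : 0 < a) (ha1 : a ≤ 1) (hp : 0 < p) {z : E} (hz : a ≤ ‖z‖) :
    a ^ p ≤ ‖stretch a p z‖ := by
  rcases le_total ‖z‖ 1 with h | h
  · rw [norm_stretch_of_mem ha0 hz h]
    gcongr
  · rw [stretch_of_one_le ha1 h]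
    exact (Real.rpow_le_one ha0.le ha1 hp.le).trans h

lemma stretch_inv_stretch (ha0 : 0 < a) (ha1 : a ≤ 1) (hp : 0 < p) (z : E) :
    stretch (a ^ p) p⁻¹ (stretch a p z) = z := by
  have hb1 : a ^ p ≤ 1 := Real.rpow_le_one ha0.le ha1 hp.le
  have hcancel {s : ℝ} (hs : 0 < s) : (s ^ p) ^ (p⁻¹ - 1) • s ^ (p - 1) • z = z := by
    rw [smul_smul, ← Real.rpow_mul hs.le, ← Real.rpow_add hs,
      show p * (p⁻¹ - 1) + (p - 1) = 0 by field_simp; ring, Real.rpow_zero, one_smul]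
  rcases le_total ‖z‖ a with h | h
  · rw [stretch_of_le hb1 (norm_stretch_of_le ha0 ha1 h), stretch_of_le ha1 h, hcancel ha0]
  rcases le_total ‖z‖ 1 with h1 | h1
  · rw [stretch_of_mem (rpow_le_norm_stretch ha0 ha1 hp h) (norm_stretch_le_one ha0 ha1 hp h1),
      norm_stretch_of_mem ha0 h h1, stretch_of_mem h h1, hcancel (ha0.trans_le h)]
  · rw [stretch_of_one_le ha1 h1, stretch_of_one_le hb1 h1]

lemma exists_lipschitzWith_stretch (ha0 : 0 < a) (ha1 : a ≤ 1) (p : ℝ) :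
    ∃ C, LipschitzWith C (stretch a p : E → E) := by
  obtain ⟨L, hL⟩ : ∃ L, LipschitzOnWith L (fun r : ℝ => r ^ (p - 1)) (Icc a 1) :=
    ContDiffOn.exists_lipschitzOnWith (n := 1) (fun r hr => (Real.contDiffAt_rpow_const_of_ne
      (ha0.trans_le hr.1).ne').contDiffWithinAt) one_ne_zero (convex_Icc a 1) isCompact_Icc
  obtain ⟨B, hB⟩ : ∃ B, ∀ r ∈ Icc a 1, ‖r ^ (p - 1)‖ ≤ B :=
    isCompact_Icc.exists_bound_of_continuousOn hL.continuousOn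
  have hclamp : LipschitzWith 1 fun r : ℝ => max a (min 1 r) :=
    (LipschitzWith.id.const_min 1).const_max a
  have hmem (r : ℝ) : max a (min 1 r) ∈ Icc a 1 :=
    ⟨le_max_left _ _, max_le ha1 (min_le_left _ _)⟩
  refine ⟨B.toNNReal + L * 1 * 1, lipschitzWith_radial (c := fun r => max a (min 1 r) ^ (p - 1))
    (fun r => (hB _ (hmem r)).trans (Real.le_coe_toNNReal B)) ?_ fun r hr => ?_⟩
  · rw [← lipschitzOnWith_univ] at hclamp ⊢
    exact hL.comp hclamp fun r _ => hmem r
  · simp only [NNReal.coe_one] at hr ⊢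
    rw [min_eq_left hr, min_self]

/-- The conjugate of `f` by the homothety `z ↦ c + r • z`. -/
noncomputable def rescale (c : E) (r : ℝ) (f : E → E) (z : E) : E := c + r • f (r⁻¹ • (z - c))

variable {c : E} {r : ℝ}

lemma rescale_center_add (hr : 0 < r) (z : E) : rescale c r f (c + r • z) = c + r • f z := by
  rw [rescale, add_sub_cancel_left, inv_smul_smul₀ hr.ne']

lemma rescale_inv_rescale (hr : 0 < r) (hgf : ∀ z, g (f z) = z) (z : E) :
    rescale c r g (rescale c r f z) = z := by
  rw [rescale.eq_1 c r f, rescale_center_add hr, hgf, smul_inv_smul₀ hr.ne', add_sub_cancel]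

lemma lipschitzWith_rescale {C : ℝ≥0} (hf : LipschitzWith C f) (c : E) (hr : 0 < r) :
    LipschitzWith C (rescale c r f) := by
  refine .of_dist_le_mul fun z w => ?_
  calc dist (c + r • f (r⁻¹ • (z - c))) (c + r • f (r⁻¹ • (w - c)))
      = r * dist (f (r⁻¹ • (z - c))) (f (r⁻¹ • (w - c))) := by
        rw [dist_add_left, dist_smul₀, Real.norm_of_nonneg hr.le]
    _ ≤ r * (C * dist (r⁻¹ • (z - c)) (r⁻¹ • (w - c))) := by gcongr; exact hf.dist_le_mul _ _
    _ = C * dist z w := by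
        rw [dist_smul₀, dist_sub_right, norm_inv, Real.norm_of_nonneg hr.le]
        field_simp

lemma norm_inv_smul_le_one_iff (hr : 0 < r) {z : E} : ‖r⁻¹ • z‖ ≤ 1 ↔ ‖z‖ ≤ r := by
  rw [norm_smul, norm_inv, Real.norm_of_nonneg hr.le, inv_mul_le_iff₀ hr, mul_one]

lemma one_le_norm_inv_smul_iff (hr : 0 < r) {z : E} : 1 ≤ ‖r⁻¹ • z‖ ↔ r ≤ ‖z‖ := by
  rw [norm_smul, norm_inv, Real.norm_of_nonneg hr.le, le_inv_mul_iff₀ hr, mul_one]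

lemma IsBallMap.rescale_of_le (hf : IsBallMap f) (hr : 0 < r) {z : E} (hz : r ≤ ‖z - c‖) :
    rescale c r f z = z := by
  rw [rescale, hf.eq_self _ ((one_le_norm_inv_smul_iff hr).2 hz), smul_inv_smul₀ hr.ne',
    add_sub_cancel]

lemma IsBallMap.norm_rescale_sub_le (hf : IsBallMap f) (hr : 0 < r) {z : E} (hz : ‖z - c‖ ≤ r) :
    ‖rescale c r f z - c‖ ≤ r := by
  rw [rescale, add_sub_cancel_left, norm_smul, Real.norm_of_nonneg hr.le]
  exact mul_le_of_le_one_right hr.le (hf.norm_le _ ((norm_inv_smul_le_one_iff hr).2 hz))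

/-- The conjugate of `f` to the ball of radius `a`, followed by the radial stretching that carries
this ball to the ball of radius `a ^ p`. -/
noncomputable def block (a p : ℝ) (f : E → E) (z : E) : E := stretch a p (rescale 0 a f z)

lemma IsBallMap.block_of_le (hf : IsBallMap f) (ha0 : 0 < a) {z : E} (hz : a ≤ ‖z‖) :
    block a p f z = stretch a p z := by
  rw [block, hf.rescale_of_le ha0 (by rwa [sub_zero])]

lemma IsBallMap.block_of_norm_le (hf : IsBallMap f) (ha0 : 0 < a) (ha1 : a ≤ 1) {z : E}
    (hz : ‖z‖ ≤ a) : block a p f z = a ^ p • f (a⁻¹ • z) := by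
  have hle := hf.norm_rescale_sub_le (c := 0) ha0 (by rwa [sub_zero])
  rw [sub_zero] at hle
  rw [block, stretch_of_le ha1 hle, rescale, zero_add, sub_zero, smul_smul,
    Real.rpow_sub_one ha0.ne', div_mul_cancel₀ _ ha0.ne']

lemma IsBallMap.block_eq_rescale_stretch (hf : IsBallMap f) (ha0 : 0 < a) (ha1 : a ≤ 1)
    (hp : 0 < p) (z : E) : block a p f z = rescale 0 (a ^ p) f (stretch a p z) := by
  have hb : 0 < a ^ p := Real.rpow_pos_of_pos ha0 p
  rcases le_total ‖z‖ a with h | h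
  · rw [hf.block_of_norm_le ha0 ha1 h, stretch_of_le ha1 h, rescale, zero_add, sub_zero, smul_smul,
      Real.rpow_sub_one ha0.ne']
    congr 3
    field_simp
  · rw [hf.block_of_le ha0 h,
      hf.rescale_of_le hb (by simpa using rpow_le_norm_stretch ha0 ha1 hp h)]

lemma IsBallMap.block (hf : IsBallMap f) (ha0 : 0 < a) (ha1 : a ≤ 1) (hp : 0 < p) :
    IsBallMap (block a p f) where
  eq_self z hz := by rw [hf.block_of_le ha0 (ha1.trans hz), stretch_of_one_le ha1 hz]
  norm_le z hz := by
    rcases le_total ‖z‖ a with h | h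
    · refine norm_stretch_le_one ha0 ha1 hp (le_trans ?_ ha1)
      simpa using hf.norm_rescale_sub_le (c := 0) ha0 (by rwa [sub_zero])
    · rw [hf.block_of_le ha0 h]
      exact norm_stretch_le_one ha0 ha1 hp hz
  lipschitz := by
    obtain ⟨C, hC⟩ := exists_lipschitzWith_stretch (E := E) ha0 ha1 p
    obtain ⟨D, hD⟩ := hf.lipschitz
    exact ⟨C * D, hC.comp (lipschitzWith_rescale hD 0 ha0)⟩

lemma block_inv_block (hf : IsBallMap f) (hgf : ∀ z, g (f z) = z) (ha0 : 0 < a) (ha1 : a ≤ 1)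
    (hp : 0 < p) (z : E) : block (a ^ p) p⁻¹ g (block a p f z) = z := by
  rw [hf.block_eq_rescale_stretch ha0 ha1 hp, block,
    rescale_inv_rescale (Real.rpow_pos_of_pos ha0 p) hgf, stretch_inv_stretch ha0 ha1 hp]

lemma dist_block_le (hf : IsBallMap f) (hg : IsBallMap g) (ha0 : 0 < a) (ha1 : a ≤ 1)
    {M : ℝ} (hM : ∀ z, dist (f z) (g z) ≤ M) (z : E) :
    dist (block a p f z) (block a p g z) ≤ a ^ p * M := by
  rcases le_total ‖z‖ a with h | h
  · rw [hf.block_of_norm_le ha0 ha1 h, hg.block_of_norm_le ha0 ha1 h, dist_smul₀,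
      Real.norm_of_nonneg (by positivity)]
    gcongr
    exact hM _
  · rw [hf.block_of_le ha0 h, hg.block_of_le ha0 h, dist_self]
    exact mul_nonneg (by positivity) (dist_nonneg.trans (hM z))

end Stretch

lemma exists_lipschitzWith_sum {ι X F : Type*} [PseudoEMetricSpace X] [SeminormedAddCommGroup F]
    {f : ι → X → F} (hf : ∀ i, ∃ C, LipschitzWith C (f i)) (s : Finset ι) :
    ∃ C, LipschitzWith C fun x => ∑ i ∈ s, f i x := by
  classical
  choose C hC using hf
  induction s using Finset.induction_on with
  | empty => exact ⟨0, by simpa only [Finset.sum_empty] using LipschitzWith.const 0⟩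
  | insert i s hi ih =>
    obtain ⟨D, hD⟩ := ih
    exact ⟨C i + D, by simpa only [Finset.sum_insert hi] using (hC i).add hD⟩

section Step

variable {E : Type*} [NormedAddCommGroup E] {P : BallPacking E} {α β : ℝ} {f g : E → E}

namespace BallPacking

lemma radius_rpow_le_one (hα : 0 ≤ α) (i : Fin P.card) : P.radius i ^ α ≤ 1 :=
  Real.rpow_le_one (P.radius_pos i).le (P.radius_le_one i) hα

lemma radius_rpow_rpow_div (hα : 0 < α) (i : Fin P.card) :
    (P.radius i ^ α) ^ (β / α) = P.radius i ^ β := by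
  rw [← Real.rpow_mul (P.radius_pos i).le, mul_div_cancel₀ _ hα.ne']

lemma radius_le_norm_sub_of_mem {i j : Fin P.card} {z : E} (hij : i ≠ j)
    (hz : ‖z - P.center i‖ ≤ P.radius i) : P.radius j ≤ ‖z - P.center j‖ := by
  have htri := dist_triangle_left (P.center i) (P.center j) z
  rw [dist_eq_norm z, dist_eq_norm z] at htri
  linarith [P.radius_add_radius_le i j hij]

lemma norm_le_one_of_mem {i : Fin P.card} {z : E} (hz : ‖z - P.center i‖ ≤ P.radius i) :
    ‖z‖ ≤ 1 := by
  linarith [P.norm_center_add_radius_le i, norm_le_norm_sub_add z (P.center i)]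

lemma exists_le_or_forall_le (P : BallPacking E) (z : E) :
    (∃ i, ‖z - P.center i‖ ≤ P.radius i) ∨ ∀ i, P.radius i ≤ ‖z - P.center i‖ :=
  (em _).imp_right fun h i => (not_le.1 (not_exists.1 h i)).le

variable [NormedSpace ℝ E]

/-- The action of `step` on the `i`-th ball of a packing. -/
noncomputable def localMap (P : BallPacking E) (α β : ℝ) (f : E → E) (i : Fin P.card) : E → E :=
  rescale (P.center i) (P.radius i) (block (P.radius i ^ α) (β / α) f)

/-- The map acting independently on the balls of a packing: on each of them, the concentric ball
contracted by `P.ratio α` is carried to the one contracted by `P.ratio β` by a conjugate of `f`, and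
the annulus around it is stretched radially. -/
noncomputable def step (P : BallPacking E) (α β : ℝ) (f : E → E) (z : E) : E :=
  z + ∑ i, (P.localMap α β f i z - z)

lemma isBallMap_block (hα : 0 < α) (hβ : 0 < β) (hf : IsBallMap f) (i : Fin P.card) :
    IsBallMap (block (P.radius i ^ α) (β / α) f) :=
  hf.block (Real.rpow_pos_of_pos (P.radius_pos i) α) (radius_rpow_le_one hα.le i) (div_pos hβ hα)

lemma localMap_of_le (hα : 0 < α) (hβ : 0 < β) (hf : IsBallMap f) {i : Fin P.card} {z : E}
    (hz : P.radius i ≤ ‖z - P.center i‖) : P.localMap α β f i z = z :=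
  (isBallMap_block hα hβ hf i).rescale_of_le (P.radius_pos i) hz

lemma norm_localMap_sub_center_le (hα : 0 < α) (hβ : 0 < β) (hf : IsBallMap f) {i : Fin P.card}
    {z : E} (hz : ‖z - P.center i‖ ≤ P.radius i) :
    ‖P.localMap α β f i z - P.center i‖ ≤ P.radius i :=
  (isBallMap_block hα hβ hf i).norm_rescale_sub_le (P.radius_pos i) hz

lemma localMap_inv_localMap (hα : 0 < α) (hβ : 0 < β) (hf : IsBallMap f) (hgf : ∀ z, g (f z) = z)
    (i : Fin P.card) (z : E) : P.localMap β α g i (P.localMap α β f i z) = z := by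
  refine rescale_inv_rescale (P.radius_pos i) (fun z => ?_) z
  rw [← radius_rpow_rpow_div (β := β) hα, ← inv_div β α]
  exact block_inv_block hf hgf (Real.rpow_pos_of_pos (P.radius_pos i) α)
    (radius_rpow_le_one hα.le i) (div_pos hβ hα) z

lemma localMap_center_add (hα : 0 < α) (hf : IsBallMap f) (i : Fin P.card) {z : E}
    (hz : ‖z‖ ≤ 1) :
    P.localMap α β f i (P.center i + P.ratio α i • z) = P.center i + P.ratio β i • f z := by
  have ha := Real.rpow_pos_of_pos (P.radius_pos i) α
  have hnorm : ‖P.radius i ^ α • z‖ ≤ P.radius i ^ α := by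
    rw [norm_smul, Real.norm_of_nonneg ha.le]
    exact mul_le_of_le_one_right ha.le hz
  rw [localMap, ratio_eq_mul, mul_smul, rescale_center_add (P.radius_pos i),
    hf.block_of_norm_le ha (radius_rpow_le_one hα.le i) hnorm, inv_smul_smul₀ ha.ne',
    radius_rpow_rpow_div hα, ratio_eq_mul, mul_smul]

lemma dist_localMap_le (hα : 0 < α) (hf : IsBallMap f) (hg : IsBallMap g) {M : ℝ}
    (hM : ∀ z, dist (f z) (g z) ≤ M) (i : Fin P.card) (z : E) :
    dist (P.localMap α β f i z) (P.localMap α β g i z) ≤ P.ratio β i * M := by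
  have hr := P.radius_pos i
  rw [localMap, localMap, rescale, rescale, dist_add_left, dist_smul₀, Real.norm_of_nonneg hr.le,
    ratio_eq_mul, mul_assoc, ← radius_rpow_rpow_div (β := β) hα]
  gcongr
  exact dist_block_le hf hg (Real.rpow_pos_of_pos hr α) (radius_rpow_le_one hα.le i) hM _

lemma localMap_congr {i : Fin P.card} {z : E}
    (hfg : f ((P.ratio α i)⁻¹ • (z - P.center i)) = g ((P.ratio α i)⁻¹ • (z - P.center i))) :
    P.localMap α β f i z = P.localMap α β g i z := by
  simp only [ratio_eq_mul, mul_inv_rev, mul_smul] at hfg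
  simp only [localMap, rescale, block, sub_zero, hfg]

lemma step_of_forall_ne_le (hα : 0 < α) (hβ : 0 < β) (hf : IsBallMap f) {i : Fin P.card} {z : E}
    (hz : ∀ j ≠ i, P.radius j ≤ ‖z - P.center j‖) : P.step α β f z = P.localMap α β f i z := by
  rw [step, Finset.sum_eq_single i _ (by simp), add_sub_cancel]
  exact fun j _ hj => by rw [localMap_of_le hα hβ hf (hz j hj), sub_self]

lemma step_of_mem (hα : 0 < α) (hβ : 0 < β) (hf : IsBallMap f) {i : Fin P.card} {z : E}
    (hz : ‖z - P.center i‖ ≤ P.radius i) : P.step α β f z = P.localMap α β f i z :=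
  step_of_forall_ne_le hα hβ hf fun _ hj => radius_le_norm_sub_of_mem hj.symm hz

lemma step_of_forall_le (hα : 0 < α) (hβ : 0 < β) (hf : IsBallMap f) {z : E}
    (hz : ∀ i, P.radius i ≤ ‖z - P.center i‖) : P.step α β f z = z := by
  rw [step, Finset.sum_eq_zero, add_zero]
  exact fun i _ => by rw [localMap_of_le hα hβ hf (hz i), sub_self]

lemma norm_step_sub_center_le (hα : 0 < α) (hβ : 0 < β) (hf : IsBallMap f) {i : Fin P.card}
    {z : E} (hz : ‖z - P.center i‖ ≤ P.radius i) :
    ‖P.step α β f z - P.center i‖ ≤ P.radius i := by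
  rw [step_of_mem hα hβ hf hz]
  exact norm_localMap_sub_center_le hα hβ hf hz

lemma isBallMap_step (hα : 0 < α) (hβ : 0 < β) (hf : IsBallMap f) :
    IsBallMap (P.step α β f) where
  eq_self z hz := step_of_forall_le hα hβ hf fun i => by
    linarith [P.norm_center_add_radius_le i, norm_le_norm_sub_add z (P.center i)]
  norm_le z hz := by
    rcases P.exists_le_or_forall_le z with ⟨i, hi⟩ | hz'
    · exact norm_le_one_of_mem (norm_step_sub_center_le hα hβ hf hi)
    · rwa [step_of_forall_le hα hβ hf hz']
  lipschitz := by
    have hlocal (i : Fin P.card) : ∃ C, LipschitzWith C fun z => P.localMap α β f i z - z := by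
      obtain ⟨C, hC⟩ := (isBallMap_block hα hβ hf i).lipschitz
      exact ⟨C + 1, (lipschitzWith_rescale hC _ (P.radius_pos i)).sub .id⟩
    obtain ⟨C, hC⟩ := exists_lipschitzWith_sum hlocal Finset.univ
    exact ⟨1 + C, LipschitzWith.id.add hC⟩

lemma step_inv_step (hα : 0 < α) (hβ : 0 < β) (hf : IsBallMap f) (hg : IsBallMap g)
    (hgf : ∀ z, g (f z) = z) (z : E) : P.step β α g (P.step α β f z) = z := by
  rcases P.exists_le_or_forall_le z with ⟨i, hi⟩ | hz
  · rw [step_of_mem hβ hα hg (norm_step_sub_center_le hα hβ hf hi), step_of_mem hα hβ hf hi,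
      localMap_inv_localMap hα hβ hf hgf]
  · rw [step_of_forall_le hα hβ hf hz, step_of_forall_le hβ hα hg hz]

lemma dist_step_le (hα : 0 < α) (hβ : 0 < β) (hP : P.Fine β) (hf : IsBallMap f) (hg : IsBallMap g)
    {M : ℝ} (hM : ∀ z, dist (f z) (g z) ≤ M) (z : E) :
    dist (P.step α β f z) (P.step α β g z) ≤ M / 2 := by
  have hM0 : 0 ≤ M := dist_nonneg.trans (hM z)
  rcases P.exists_le_or_forall_le z with ⟨i, hi⟩ | hz
  · rw [step_of_mem hα hβ hf hi, step_of_mem hα hβ hg hi]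
    linarith [dist_localMap_le (β := β) hα hf hg hM i z,
      mul_le_mul_of_nonneg_right (hP.ratio_le_half i) hM0]
  · rw [step_of_forall_le hα hβ hf hz, step_of_forall_le hα hβ hg hz, dist_self]
    positivity

lemma step_congr {z : E} (hfg : ∀ i, f ((P.ratio α i)⁻¹ • (z - P.center i)) =
    g ((P.ratio α i)⁻¹ • (z - P.center i))) : P.step α β f z = P.step α β g z := by
  simp only [step, fun i => localMap_congr (β := β) (hfg i)]

lemma step_center_add (hα : 0 < α) (hβ : 0 < β) (hf : IsBallMap f) (i : Fin P.card) {z : E}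
    (hz : ‖z‖ ≤ 1) :
    P.step α β f (P.center i + P.ratio α i • z) = P.center i + P.ratio β i • f z := by
  rw [step_of_mem hα hβ hf (i := i), localMap_center_add hα hf i hz]
  rw [add_sub_cancel_left, norm_smul, Real.norm_of_nonneg (ratio_pos i).le, ratio_eq_mul, mul_assoc]
  exact mul_le_of_le_one_right (P.radius_pos i).le
    (mul_le_one₀ (radius_rpow_le_one hα.le i) (norm_nonneg z) hz)

end BallPacking

end Step

lemma exists_tendstoUniformly_of_dist_le {X Y : Type*} [PseudoMetricSpace Y] [CompleteSpace Y]
    {f : ℕ → X → Y} {C : ℝ} (hf : ∀ m x, dist (f m x) (f (m + 1) x) ≤ C / 2 / 2 ^ m) :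
    ∃ F, TendstoUniformly f F atTop := by
  choose F hF using fun x =>
    cauchySeq_tendsto_of_complete (cauchySeq_of_le_geometric_two fun m => hf m x)
  refine ⟨F, Metric.tendstoUniformly_iff.2 fun ε hε => ?_⟩
  have hlim : Tendsto (fun m : ℕ => C / 2 ^ m) atTop (𝓝 0) :=
    tendsto_const_nhds.div_atTop (tendsto_pow_atTop_atTop_of_one_lt one_lt_two)
  filter_upwards [hlim.eventually_lt_const hε] with m hm x
  rw [dist_comm]
  exact (dist_le_of_le_geometric_two_of_tendsto (fun m => hf m x) (hF x) m).trans_lt hm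

section UniformLimit

variable {ι X Y : Type*} [UniformSpace X] [UniformSpace Y] [T2Space X] {l : Filter ι} [l.NeBot]
  {f : ι → X → Y} {g : ι → Y → X} {F : X → Y} {G : Y → X}

lemma leftInverse_of_tendstoUniformly (hf : TendstoUniformly f F l) (hg : TendstoUniformly g G l)
    (hgc : ∀ m, Continuous (g m)) (h : ∀ m x, g m (f m x) = x) (x : X) : G (F x) = x := by
  have hG : Continuous G := hg.continuous (.of_forall hgc)
  have hlim : Tendsto (fun m => g m (f m x)) l (𝓝 (G (F x))) :=
    hg.tendstoLocallyUniformly.tendsto_comp hG.continuousAt (hf.tendsto_at x)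
  simp only [h] at hlim
  exact tendsto_nhds_unique hlim tendsto_const_nhds

lemma isHomeomorph_of_tendstoUniformly [T2Space Y] (hf : TendstoUniformly f F l)
    (hg : TendstoUniformly g G l) (hfc : ∀ m, Continuous (f m)) (hgc : ∀ m, Continuous (g m))
    (hgf : ∀ m x, g m (f m x) = x) (hfg : ∀ m y, f m (g m y) = y) : IsHomeomorph F :=
  Homeomorph.isHomeomorph
    { toFun := F
      invFun := G
      left_inv := leftInverse_of_tendstoUniformly hf hg hgc hgf
      right_inv := leftInverse_of_tendstoUniformly hg hf hfc hfg
      continuous_toFun := hf.continuous (.of_forall hfc)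
      continuous_invFun := hg.continuous (.of_forall hgc) }

end UniformLimit

section Approx

variable {E : Type*} [NormedAddCommGroup E] [NormedSpace ℝ E] {α β : ℝ} {P : ℕ → BallPacking E}

/-- The `m`-th approximation to the map carrying the Cantor set with parameter `α` to the one with
parameter `β`. -/
noncomputable def approx (α β : ℝ) : ℕ → (ℕ → BallPacking E) → E → E
  | 0, _ => id
  | m + 1, P => (P 0).step α β (approx α β m fun j => P (j + 1))

lemma isBallMap_approx (hα : 0 < α) (hβ : 0 < β) (m : ℕ) : IsBallMap (approx α β m P) := by
  induction m generalizing P with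
  | zero => exact isBallMap_id
  | succ m ih => exact BallPacking.isBallMap_step hα hβ ih

lemma approx_inv_approx (hα : 0 < α) (hβ : 0 < β) (m : ℕ) (z : E) :
    approx β α m P (approx α β m P z) = z := by
  induction m generalizing P z with
  | zero => rfl
  | succ m ih =>
    exact BallPacking.step_inv_step hα hβ (isBallMap_approx hα hβ m) (isBallMap_approx hβ hα m) ih z

lemma dist_approx_succ_le (hα : 0 < α) (hβ : 0 < β) (hPβ : ∀ n, (P n).Fine β) (m : ℕ) (z : E) :
    dist (approx α β m P z) (approx α β (m + 1) P z) ≤ 4 / 2 / 2 ^ m := by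
  induction m generalizing P z with
  | zero =>
    norm_num
    exact (isBallMap_approx hα hβ 0).dist_le_two (isBallMap_approx hα hβ 1) z
  | succ m ih =>
    rw [pow_succ, ← div_div]
    exact BallPacking.dist_step_le hα hβ (hPβ 0) (isBallMap_approx hα hβ m)
      (isBallMap_approx hα hβ (m + 1)) (ih fun n => hPβ (n + 1)) z

lemma exists_tendstoUniformly_approx [CompleteSpace E] (hα : 0 < α) (hβ : 0 < β)
    (hPβ : ∀ n, (P n).Fine β) :
    ∃ F, TendstoUniformly (fun m => approx α β m P) F atTop :=
  exists_tendstoUniformly_of_dist_le (dist_approx_succ_le hα hβ hPβ)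

lemma isHomeomorph_of_tendstoUniformly_approx [CompleteSpace E] (hα : 0 < α) (hβ : 0 < β)
    (hPα : ∀ n, (P n).Fine α) {F : E → E}
    (hF : TendstoUniformly (fun m => approx α β m P) F atTop) : IsHomeomorph F := by
  obtain ⟨G, hG⟩ := exists_tendstoUniformly_approx hβ hα hPα
  exact isHomeomorph_of_tendstoUniformly hF hG (fun m => (isBallMap_approx hα hβ m).continuous)
    (fun m => (isBallMap_approx hβ hα m).continuous) (approx_inv_approx hα hβ)
    (approx_inv_approx hβ hα)

lemma eq_self_of_tendsto_approx (hα : 0 < α) (hβ : 0 < β) {F : E → E} {z : E}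
    (hF : Tendsto (fun m => approx α β m P z) atTop (𝓝 (F z))) (hz : 1 ≤ ‖z‖) : F z = z :=
  tendsto_nhds_unique hF <| tendsto_const_nhds.congr fun m =>
    ((isBallMap_approx hα hβ m).eq_self z hz).symm

lemma dist_approx_codePoint_le [CompleteSpace E] (hα : 0 < α) (hβ : 0 < β)
    (hPα : ∀ n, (P n).Fine α) (hPβ : ∀ n, (P n).Fine β) (m : ℕ) (w : Code P) :
    dist (approx α β m P (codePoint α P w)) (codePoint β P w) ≤ 2 * (1 / 2) ^ m := by
  induction m generalizing P with
  | zero =>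
    rw [approx, id, pow_zero, mul_one]
    linarith [dist_le_norm_add_norm (codePoint α P w) (codePoint β P w),
      norm_codePoint_le_one hPα w, norm_codePoint_le_one hPβ w]
  | succ m ih =>
    rw [codePoint_eq_add hPα, codePoint_eq_add hPβ, approx,
      BallPacking.step_center_add hα hβ (isBallMap_approx hα hβ m) _
        (norm_codePoint_le_one (fun n => hPα (n + 1)) _),
      dist_add_left, dist_smul₀, Real.norm_of_nonneg (BallPacking.ratio_pos _).le]
    calc _ ≤ 1 / 2 * (2 * (1 / 2) ^ m) :=
          mul_le_mul ((hPβ 0).ratio_le_half _) (ih (fun n => hPα (n + 1)) (fun n => hPβ (n + 1)) _)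
            dist_nonneg (by norm_num)
      _ = 2 * (1 / 2) ^ (m + 1) := by ring

lemma image_packingCantorSet_of_tendsto_approx [CompleteSpace E] (hα : 0 < α) (hβ : 0 < β)
    (hPα : ∀ n, (P n).Fine α) (hPβ : ∀ n, (P n).Fine β) {F : E → E}
    (hF : ∀ z, Tendsto (fun m => approx α β m P z) atTop (𝓝 (F z))) :
    F '' packingCantorSet α P = packingCantorSet β P := by
  have hcode (w : Code P) : F (codePoint α P w) = codePoint β P w := by
    refine tendsto_nhds_unique (hF _) (tendsto_iff_dist_tendsto_zero.2 ?_)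
    refine squeeze_zero (fun _ => dist_nonneg)
      (fun m => dist_approx_codePoint_le hα hβ hPα hPβ m w) ?_
    simpa using (tendsto_pow_atTop_nhds_zero_of_lt_one (r := (1 / 2 : ℝ)) (by norm_num)
      (by norm_num)).const_mul 2
  rw [packingCantorSet, ← range_comp, packingCantorSet]
  exact congrArg range (funext hcode)

/-- The union of the balls of the `m`-th generation of the Cantor set. -/
def generation (α : ℝ) : ℕ → (ℕ → BallPacking E) → Set E
  | 0, _ => closedBall 0 1
  | m + 1, P => ⋃ i, (fun z => (P 0).center i + (P 0).ratio α i • z) ''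
      generation α m fun j => P (j + 1)

lemma isCompact_generation [ProperSpace E] (m : ℕ) (P : ℕ → BallPacking E) :
    IsCompact (generation α m P) := by
  induction m generalizing P with
  | zero => exact isCompact_closedBall 0 1
  | succ m ih => exact isCompact_iUnion fun i => (ih _).image (by fun_prop)

lemma approx_add_of_notMem_generation (hα : 0 < α) (hβ : 0 < β) (m k : ℕ) {z : E}
    (hz : z ∉ generation α m P) : approx α β (m + k) P z = approx α β m P z := by
  induction m generalizing P z with
  | zero =>
    simp only [generation, mem_closedBall_zero_iff, not_le] at hz
    rw [(isBallMap_approx hα hβ _).eq_self z hz.le, (isBallMap_approx hα hβ _).eq_self z hz.le]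
  | succ m ih =>
    rw [Nat.succ_add]
    refine BallPacking.step_congr fun i => ih fun h => hz (mem_iUnion.2 ⟨i, _, h, ?_⟩)
    simp only [smul_inv_smul₀ (BallPacking.ratio_pos i).ne', add_sub_cancel]

lemma eq_approx_of_notMem_generation (hα : 0 < α) (hβ : 0 < β) {F : E → E} {z : E}
    (hF : Tendsto (fun m => approx α β m P z) atTop (𝓝 (F z))) {m : ℕ}
    (hz : z ∉ generation α m P) : F z = approx α β m P z :=
  tendsto_nhds_unique (hF.comp (tendsto_add_atTop_nat m)) <| tendsto_const_nhds.congr fun k => by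
    rw [Function.comp_apply, add_comm, approx_add_of_notMem_generation hα hβ m k hz]

variable [FiniteDimensional ℝ E]

lemma BallPacking.Fine.sum_ratio_pow_le {Q : BallPacking E} (hQ : Q.Fine α) :
    ∑ i, Q.ratio α i ^ finrank ℝ E ≤ (1 / 2) ^ finrank ℝ E :=
  calc ∑ i, Q.ratio α i ^ finrank ℝ E ≤ ∑ i, (Q.radius i / 2) ^ finrank ℝ E :=
        Finset.sum_le_sum fun i _ => pow_le_pow_left₀ (ratio_pos i).le (hQ.ratio_le i) _
    _ = (1 / 2) ^ finrank ℝ E * Q.mass := by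
        simp only [mass, Finset.mul_sum, ← mul_pow, one_div_mul_eq_div]
    _ ≤ (1 / 2) ^ finrank ℝ E := mul_le_of_le_one_right (by positivity) Q.mass_le_one

variable [MeasurableSpace E] [BorelSpace E] (μ : Measure E) [μ.IsAddHaarMeasure]

lemma measure_generation_le (hPα : ∀ n, (P n).Fine α) (m : ℕ) :
    μ (generation α m P) ≤
      ENNReal.ofReal ((1 / 2) ^ finrank ℝ E) ^ m * μ (closedBall (0 : E) 1) := by
  induction m generalizing P with
  | zero => simp [generation]
  | succ m ih =>
    set B := ENNReal.ofReal ((1 / 2) ^ finrank ℝ E) ^ m * μ (closedBall (0 : E) 1)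
    have himage (i : Fin (P 0).card) : μ ((fun z => (P 0).center i + (P 0).ratio α i • z) ''
        generation α m fun j => P (j + 1)) ≤
          ENNReal.ofReal ((P 0).ratio α i ^ finrank ℝ E) * B := by
      rw [← image_image (fun z => (P 0).center i + z), image_add_left, measure_preimage_add,
        image_smul, Measure.addHaar_smul, abs_of_pos (pow_pos (BallPacking.ratio_pos i) _)]
      gcongr
      exact ih fun n => hPα (n + 1)
    calc μ (generation α (m + 1) P)
        ≤ ∑ i, ENNReal.ofReal ((P 0).ratio α i ^ finrank ℝ E) * B :=
          (measure_iUnion_fintype_le _ _).trans (Finset.sum_le_sum fun i _ => himage i)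
      _ = ENNReal.ofReal (∑ i, (P 0).ratio α i ^ finrank ℝ E) * B := by
          rw [← Finset.sum_mul, ENNReal.ofReal_sum_of_nonneg
            fun i _ => (pow_pos (BallPacking.ratio_pos i) _).le]
      _ ≤ ENNReal.ofReal ((1 / 2) ^ finrank ℝ E) * B := by
          gcongr
          exact (hPα 0).sum_ratio_pow_le
      _ = _ := by rw [← mul_assoc, ← pow_succ']

lemma tendsto_measure_generation [Nontrivial E] (hPα : ∀ n, (P n).Fine α) :
    Tendsto (fun m => μ (generation α m P)) atTop (𝓝 0) := by
  have hlt : ENNReal.ofReal ((1 / 2) ^ finrank ℝ E) < 1 := by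
    rw [ENNReal.ofReal_lt_one]
    exact pow_lt_one₀ (by norm_num) (by norm_num) finrank_pos.ne'
  refine tendsto_of_tendsto_of_tendsto_of_le_of_le tendsto_const_nhds ?_ (fun _ => zero_le)
    (measure_generation_le μ hPα)
  simpa using ENNReal.Tendsto.mul_const (ENNReal.tendsto_pow_atTop_nhds_zero_of_lt_one hlt)
    (.inr (measure_closedBall_lt_top (x := (0 : E)) (r := 1)).ne)

end Approx

section Orientation

open Complex (exp I)

lemma eq_of_exp_eq_one {X : Type*} [TopologicalSpace X] [PreconnectedSpace X] {g : X → ℂ}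
    (hg : Continuous g) (h : ∀ x, exp (g x) = 1) (x y : X) : g x = g y :=
  congrFun (Complex.isCoveringMap_exp.eq_of_comp_eq hg continuous_const
    (funext fun x => Subtype.ext ((h x).trans (h y).symm)) y rfl) x

lemma exists_continuous_log {u : ℂ → ℂ} (hu : Continuous u) (h0 : ∀ w, u w ≠ 0) :
    ∃ L : ℂ → ℂ, Continuous L ∧ ∀ w, exp (L w) = u w := by
  obtain ⟨L, ⟨-, hL⟩, -⟩ := Complex.isCoveringMap_exp.existsUnique_continuousMap_lifts
    (⟨fun w => ⟨u w, h0 w⟩, by fun_prop⟩ : C(ℂ, {z : ℂ // z ≠ 0})) 0 (Complex.log (u 0))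
    (Subtype.ext (Complex.exp_log (h0 0)))
  exact ⟨L, L.continuous, fun w => congrArg Subtype.val (congrFun hL w)⟩

lemma add_two_pi_mul_I_sub_eq {L : ℂ → ℂ} (hL : Continuous L)
    (hper : ∀ w, exp (L (w + 2 * Real.pi * I)) = exp (L w)) {ρ : ℝ}
    (hslit : ∀ θ : ℝ, exp (L (ρ + θ * I) - (ρ + θ * I)) ∈ Complex.slitPlane) (w : ℂ) :
    L (w + 2 * Real.pi * I) - L w = 2 * Real.pi * I := by
  have hconst : L (w + 2 * Real.pi * I) - L w = L (ρ + 2 * Real.pi * I) - L ρ :=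
    eq_of_exp_eq_one (g := fun w => L (w + 2 * Real.pi * I) - L w) (by fun_prop)
      (fun w => by rw [Complex.exp_sub, hper, div_self (Complex.exp_ne_zero _)]) w ρ
  let v : ℝ → ℂ := fun θ => L (ρ + θ * I) - (ρ + θ * I)
  have hv : Continuous v := by fun_prop
  have hvexp : exp (v (2 * Real.pi)) = exp (v 0) := by
    simp only [v, Complex.exp_sub]
    push_cast
    rw [hper, Complex.exp_add, Complex.exp_two_pi_mul_I, mul_one, zero_mul, add_zero]
  have hline := eq_of_exp_eq_one (g := fun θ => v θ - Complex.log (exp (v θ)))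
    (hv.sub ((Complex.continuous_exp.comp hv).clog hslit))
    (fun θ => by rw [Complex.exp_sub, Complex.exp_log (Complex.exp_ne_zero _),
      div_self (Complex.exp_ne_zero _)]) (2 * Real.pi) 0
  simp only [hvexp, sub_left_inj, v] at hline
  push_cast at hline
  rw [zero_mul, add_zero] at hline
  linear_combination hconst + hline

lemma exists_exp_sub_mem_slitPlane {F : ℂ → ℂ} (hF : F =ᶠ[cocompact ℂ] id) (c b : ℂ) :
    ∃ ρ : ℝ, ∀ θ : ℝ, (F (c + exp (ρ + θ * I)) - b) / exp (ρ + θ * I) ∈ Complex.slitPlane := by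
  obtain ⟨R, -, hR⟩ := (hasBasis_cobounded_norm (E := ℂ)).mem_iff.1
    (cobounded_eq_cocompact (α := ℂ) ▸ hF)
  obtain ⟨ρ, hρ⟩ : ∃ ρ : ℝ, 1 + ‖c‖ + |R| + ‖c - b‖ ≤ Real.exp ρ :=
    (Real.tendsto_exp_atTop.eventually_ge_atTop _).exists
  refine ⟨ρ, fun θ => ?_⟩
  have hnorm : ‖exp (ρ + θ * I)‖ = Real.exp ρ := by simp [Complex.norm_exp]
  have hid : F (c + exp (ρ + θ * I)) = c + exp (ρ + θ * I) := by
    refine hR ?_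
    have := norm_sub_le_norm_add (exp (ρ + θ * I)) c
    rw [hnorm, add_comm] at this
    exact (show R ≤ _ by linarith [le_abs_self R, norm_nonneg (c - b)])
  rw [hid, add_sub_right_comm, add_div, div_self (Complex.exp_ne_zero _), add_comm]
  refine Complex.mem_slitPlane_of_norm_lt_one ?_
  rw [norm_div, hnorm, div_lt_one (Real.exp_pos _)]
  linarith [norm_nonneg c, abs_nonneg R]

theorem isOrientationPreserving_of_eventuallyEq_id {F : ℂ → ℂ} (hF : Continuous F)
    (hinj : Function.Injective F) (hid : F =ᶠ[cocompact ℂ] id) : IsOrientationPreserving F := by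
  intro c r hr
  obtain ⟨L, hLc, hL⟩ := exists_continuous_log (u := fun w => F (c + exp w) - F c) (by fun_prop)
    fun w => sub_ne_zero.2 fun h => Complex.exp_ne_zero w (add_eq_left.1 (hinj h))
  have hper (w : ℂ) : exp (L (w + 2 * Real.pi * I)) = exp (L w) := by
    rw [hL, hL, Complex.exp_add w, Complex.exp_two_pi_mul_I, mul_one]
  obtain ⟨ρ, hρ⟩ := exists_exp_sub_mem_slitPlane hid c (F c)
  have hincr := add_two_pi_mul_I_sub_eq hLc hper
    (fun θ => by rw [Complex.exp_sub, hL]; exact hρ θ) (Real.log r)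
  refine ⟨fun θ => L (Real.log r + θ * I), by fun_prop, fun θ => ?_, ?_⟩
  · rw [hL, Complex.exp_add, ← Complex.ofReal_exp, Real.exp_log hr, circleMap]
  · rw [← hincr]
    simp

end Orientation

section Distortion

variable {E F : Type*} [NormedAddCommGroup E] [NormedSpace ℝ E] [NormedAddCommGroup F]
  [NormedSpace ℝ F] {K : ℝ}

/-- The norms of the images of vectors of equal length under `A` differ by a factor of at most
`K`. -/
def HasDistortion (K : ℝ) (A : E →L[ℝ] F) : Prop := ∀ u v, ‖u‖ = ‖v‖ → ‖A u‖ ≤ K * ‖A v‖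

/-- `f` is differentiable at `z`, with derivative of distortion at most `K`. -/
def HasDistortionAt (K : ℝ) (f : E → F) (z : E) : Prop :=
  ∃ A : E →L[ℝ] F, HasFDerivAt f A z ∧ HasDistortion K A

lemma hasDistortion_of_bounds {A : E →L[ℝ] F} {l : ℝ} (hK : 0 ≤ K) (hl : ∀ v, l * ‖v‖ ≤ ‖A v‖)
    (hu : ∀ v, ‖A v‖ ≤ K * (l * ‖v‖)) : HasDistortion K A := fun u v huv =>
  (hu u).trans (mul_le_mul_of_nonneg_left (huv ▸ hl v) hK)

lemma HasDistortion.smul {A : E →L[ℝ] F} (h : HasDistortion K A) (r : ℝ) :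
    HasDistortion K (r • A) := fun u v huv => by
  simp only [smul_apply, norm_smul, mul_left_comm K]
  exact mul_le_mul_of_nonneg_left (h u v huv) (norm_nonneg r)

lemma HasDistortion.opNorm_mul_le {A : E →L[ℝ] F} (h : HasDistortion K A) (v : E) :
    ‖A‖ * ‖v‖ ≤ K * ‖A v‖ := by
  rcases eq_or_ne v 0 with rfl | hv
  · simp
  have hv0 : 0 < ‖v‖ := norm_pos_iff.2 hv
  have hbound (u : E) : ‖A u‖ * ‖v‖ ≤ K * ‖A v‖ * ‖u‖ := by
    have hcomm : ‖(‖v‖ : ℝ) • u‖ = ‖(‖u‖ : ℝ) • v‖ := by simp [norm_smul, mul_comm]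
    have := h _ _ hcomm
    simp only [map_smul, norm_smul, norm_norm] at this
    linarith
  have hnonneg : 0 ≤ K * ‖A v‖ := (norm_nonneg (A v)).trans (h v v rfl)
  rw [← le_div_iff₀ hv0]
  refine A.opNorm_le_bound (by positivity) fun u => ?_
  rw [div_mul_eq_mul_div, le_div_iff₀ hv0]
  exact hbound u

lemma pow_finrank_le_abs_det [FiniteDimensional ℝ E] {A : E →L[ℝ] E} {l : ℝ} (hl : 0 ≤ l)
    (h : ∀ v, l * ‖v‖ ≤ ‖A v‖) : l ^ finrank ℝ E ≤ |A.det| := by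
  borelize E
  let μ : Measure E := Measure.addHaar
  rcases hl.eq_or_lt with rfl | hl0
  · rcases eq_or_ne (finrank ℝ E) 0 with hd | hd
    · have := finrank_zero_iff.1 hd
      simp [ContinuousLinearMap.det, LinearMap.det_eq_one_of_subsingleton, hd]
    · simp [hd]
  have hinj : Function.Injective (A : E →ₗ[ℝ] E) := (injective_iff_map_eq_zero _).2 fun v hv => by
    have hv0 := h v
    rw [show A v = 0 from hv, norm_zero] at hv0
    exact norm_le_zero_iff.1 (nonpos_of_mul_nonpos_right hv0 hl0)
  have hsub : ball (0 : E) l ⊆ A '' ball 0 1 := fun y hy => by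
    obtain ⟨x, rfl⟩ := LinearMap.injective_iff_surjective.1 hinj y
    refine ⟨x, mem_ball_zero_iff.2 ?_, rfl⟩
    exact (mul_lt_iff_lt_one_right hl0).1 ((h x).trans_lt (mem_ball_zero_iff.1 hy))
  have hvol := measure_mono (μ := μ) hsub
  rwa [Measure.addHaar_image_continuousLinearMap, Measure.addHaar_ball_of_pos μ _ hl0,
    ENNReal.mul_le_mul_iff_left (measure_ball_pos μ 0 one_pos).ne' measure_ball_lt_top.ne,
    ENNReal.ofReal_le_ofReal_iff (abs_nonneg _)] at hvol

lemma HasDistortion.norm_pow_finrank_le [FiniteDimensional ℝ E] {A : E →L[ℝ] E} (hK : 0 ≤ K)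
    (h : HasDistortion K A) : ‖A‖ ^ finrank ℝ E ≤ K ^ finrank ℝ E * |A.det| := by
  have hle := pow_finrank_le_abs_det (A := K • A) (norm_nonneg A) fun v => by
    rw [smul_apply, norm_smul, Real.norm_of_nonneg hK]
    exact h.opNorm_mul_le v
  rwa [ContinuousLinearMap.det, ContinuousLinearMap.toLinearMap_smul, LinearMap.det_smul, abs_mul,
    abs_of_nonneg (by positivity)] at hle

lemma HasDistortionAt.congr {f g : E → F} {z : E} (h : HasDistortionAt K f z) (hfg : g =ᶠ[𝓝 z] f) :
    HasDistortionAt K g z := by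
  obtain ⟨A, hA, hAK⟩ := h
  exact ⟨A, hA.congr_of_eventuallyEq hfg, hAK⟩

lemma hasDistortionAt_id (hK : 1 ≤ K) (z : E) : HasDistortionAt K id z :=
  ⟨_, hasFDerivAt_id z, hasDistortion_of_bounds (l := 1) (zero_le_one.trans hK) (by simp)
    fun v => by simpa using le_mul_of_one_le_left (norm_nonneg v) hK⟩

lemma HasDistortionAt.affine {f : E → F} {z c : E} {r : ℝ}
    (h : HasDistortionAt K f (r⁻¹ • (z - c))) (d : F) (s : ℝ) :
    HasDistortionAt K (fun w => d + s • f (r⁻¹ • (w - c))) z := by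
  obtain ⟨A, hA, hAK⟩ := h
  have hinner : HasFDerivAt (fun w => r⁻¹ • (w - c)) (r⁻¹ • ContinuousLinearMap.id ℝ E) z :=
    ((hasFDerivAt_id z).sub_const c).const_smul r⁻¹
  refine ⟨(s * r⁻¹) • A, ?_, hAK.smul _⟩
  refine (((hA.comp z hinner).const_smul s).const_add d).congr_fderiv ?_
  ext v
  simp [mul_smul]

end Distortion

section RadialDistortion

variable {E : Type*} [NormedAddCommGroup E] [InnerProductSpace ℝ E] {p : ℝ} {z : E}

lemma hasFDerivAt_norm_rpow_smul (hz : z ≠ 0) (p : ℝ) :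
    HasFDerivAt (fun w : E => ‖w‖ ^ (p - 1) • w) (‖z‖ ^ (p - 1) •
      (ContinuousLinearMap.id ℝ E + ((p - 1) / ‖z‖ ^ 2) • (innerSL ℝ z).smulRight z)) z := by
  have hsq (w : E) : (‖w‖ ^ 2) ^ ((p - 1) / 2) = ‖w‖ ^ (p - 1) := by
    rw [← Real.rpow_two, ← Real.rpow_mul (norm_nonneg w)]
    congr 1
    ring
  have hz0 : 0 < ‖z‖ := norm_pos_iff.2 hz
  have hderiv := ((hasStrictFDerivAt_norm_sq z).hasFDerivAt.rpow_const (p := (p - 1) / 2)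
    (.inl (by positivity))).smul (hasFDerivAt_id z)
  simp only [hsq, Real.rpow_sub_one (pow_pos hz0 2).ne'] at hderiv
  refine hderiv.congr_fderiv (ContinuousLinearMap.ext fun v => ?_)
  simp [smul_smul]
  module

lemma sq_norm_add_smul_inner (hz : z ≠ 0) (p : ℝ) (v : E) :
    ‖v + ((p - 1) / ‖z‖ ^ 2) • inner ℝ z v • z‖ ^ 2 =
      ‖v‖ ^ 2 + (p ^ 2 - 1) * (inner ℝ z v ^ 2 / ‖z‖ ^ 2) := by
  have hz0 : ‖z‖ ≠ 0 := norm_ne_zero_iff.2 hz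
  rw [norm_add_sq_real, real_inner_smul_right, real_inner_smul_right, real_inner_comm, norm_smul,
    norm_smul, mul_pow, mul_pow, Real.norm_eq_abs, Real.norm_eq_abs, sq_abs, sq_abs]
  field_simp
  ring

lemma hasDistortionAt_norm_rpow_smul (hp0 : 0 < p) (hp1 : p ≤ 1) (hz : z ≠ 0) :
    HasDistortionAt p⁻¹ (fun w => ‖w‖ ^ (p - 1) • w) z := by
  refine ⟨_, hasFDerivAt_norm_rpow_smul hz p, HasDistortion.smul ?_ _⟩
  have hp2 : p ^ 2 ≤ 1 := pow_le_one₀ hp0.le hp1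
  have hs0 (v : E) : 0 ≤ inner ℝ z v ^ 2 / ‖z‖ ^ 2 := by positivity
  have hs1 (v : E) : inner ℝ z v ^ 2 / ‖z‖ ^ 2 ≤ ‖v‖ ^ 2 := by
    rw [div_le_iff₀ (by positivity), mul_comm, ← mul_pow]
    exact sq_le_sq' (by linarith [neg_abs_le (inner ℝ z v), abs_real_inner_le_norm z v])
      (real_inner_le_norm z v)
  refine hasDistortion_of_bounds (l := p) (inv_pos.2 hp0).le (fun v => ?_) fun v => ?_
  · refine (sq_le_sq₀ (by positivity) (norm_nonneg _)).1 ((?_ : _ ≤ _).trans_eq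
      (sq_norm_add_smul_inner hz p v).symm)
    nlinarith [hs1 v]
  · rw [inv_mul_cancel_left₀ hp0.ne']
    refine (sq_le_sq₀ (norm_nonneg _) (norm_nonneg _)).1
      ((sq_norm_add_smul_inner hz p v).trans_le ?_)
    nlinarith [hs0 v]

end RadialDistortion

section AEDistortion

variable {E : Type*} [NormedAddCommGroup E] [InnerProductSpace ℝ E] [FiniteDimensional ℝ E]
  [MeasurableSpace E] [BorelSpace E] {μ : Measure E} [μ.IsAddHaarMeasure] {f : E → E}
  {K α β : ℝ}

lemma ae_comp_affine {q : E → Prop} (h : ∀ᵐ z ∂μ, q z) (c : E) {r : ℝ} (hr : r ≠ 0) :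
    ∀ᵐ z ∂μ, q (r⁻¹ • (z - c)) :=
  ((Measure.quasiMeasurePreserving_smul μ (inv_ne_zero hr)).comp
    (measurePreserving_sub_right μ c).quasiMeasurePreserving).ae h

variable [Nontrivial E]

lemma ae_norm_sub_ne (c : E) (r : ℝ) : ∀ᵐ z ∂μ, ‖z - c‖ ≠ r := by
  filter_upwards [compl_mem_ae_iff.2 (Measure.addHaar_sphere μ c r)] with z hz h
  exact hz (by rwa [mem_sphere, dist_eq_norm])

lemma ae_hasDistortionAt_block {p : ℝ} (hp0 : 0 < p) (hp1 : p ≤ 1) (hf : IsBallMap f)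
    (hD : ∀ᵐ z ∂μ, HasDistortionAt p⁻¹ f z) {a : ℝ} (ha0 : 0 < a) (ha1 : a ≤ 1) :
    ∀ᵐ z ∂μ, HasDistortionAt p⁻¹ (block a p f) z := by
  filter_upwards [ae_comp_affine hD 0 ha0.ne', ae_norm_sub_ne 0 a, ae_norm_sub_ne 0 1]
    with z hz hza hz1
  rw [sub_zero] at hza hz1
  have hcont : ContinuousAt (fun w : E => ‖w‖) z := by fun_prop
  rcases lt_or_gt_of_ne hza with h | h
  · refine (hz.affine 0 (a ^ p)).congr ?_
    filter_upwards [hcont.eventually_lt_const h] with w hw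
    rw [zero_add, sub_zero, hf.block_of_norm_le ha0 ha1 hw.le]
  rcases lt_or_gt_of_ne hz1 with h1 | h1
  · refine (hasDistortionAt_norm_rpow_smul hp0 hp1 (norm_pos_iff.1 (ha0.trans h))).congr ?_
    filter_upwards [hcont.eventually_const_lt h, hcont.eventually_lt_const h1] with w hw hw1
    rw [hf.block_of_le ha0 hw.le, stretch_of_mem hw.le hw1.le]
  · refine (hasDistortionAt_id (one_le_inv₀ hp0 |>.2 hp1) z).congr ?_
    filter_upwards [hcont.eventually_const_lt h1] with w hw
    exact (hf.block ha0 ha1 hp0).eq_self w hw.le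

lemma ae_hasDistortionAt_step (hβ : 0 < β) (hβα : β ≤ α) (hf : IsBallMap f)
    (hD : ∀ᵐ z ∂μ, HasDistortionAt (α / β) f z) (P : BallPacking E) :
    ∀ᵐ z ∂μ, HasDistortionAt (α / β) (P.step α β f) z := by
  have hα : 0 < α := hβ.trans_le hβα
  have hblock (i : Fin P.card) :
      ∀ᵐ z ∂μ, HasDistortionAt (α / β) (block (P.radius i ^ α) (β / α) f) z := by
    rw [← inv_div β α] at hD ⊢
    exact ae_hasDistortionAt_block (div_pos hβ hα) (div_le_one_of_le₀ hβα hα.le) hf hD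
      (Real.rpow_pos_of_pos (P.radius_pos i) α) (BallPacking.radius_rpow_le_one hα.le i)
  filter_upwards [ae_all_iff.2 fun i => ae_comp_affine (hblock i) (P.center i) (P.radius_pos i).ne',
    ae_all_iff.2 fun i => ae_norm_sub_ne (P.center i) (P.radius i)] with z hz hne
  have hcont (i : Fin P.card) : ContinuousAt (fun w => ‖w - P.center i‖) z := by fun_prop
  rcases P.exists_le_or_forall_le z with ⟨i, hi⟩ | h
  · refine ((hz i).affine (P.center i) (P.radius i)).congr ?_
    filter_upwards [(hcont i).eventually_lt_const (hi.lt_of_ne (hne i))] with w hw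
    exact BallPacking.step_of_mem hα hβ hf hw.le
  · refine (hasDistortionAt_id ((one_le_div₀ hβ).2 hβα) z).congr ?_
    filter_upwards [eventually_all.2 fun i =>
      (hcont i).eventually_const_lt ((h i).lt_of_ne (hne i).symm)] with w hw
    exact BallPacking.step_of_forall_le hα hβ hf fun i => (hw i).le

lemma ae_hasDistortionAt_approx (hβ : 0 < β) (hβα : β ≤ α) (m : ℕ) (P : ℕ → BallPacking E) :
    ∀ᵐ z ∂μ, HasDistortionAt (α / β) (approx α β m P) z := by
  induction m generalizing P with
  | zero => exact .of_forall fun z => hasDistortionAt_id ((one_le_div₀ hβ).2 hβα) z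
  | succ m ih =>
    exact ae_hasDistortionAt_step hβ hβα (isBallMap_approx (hβ.trans_le hβα) hβ m) (ih _) (P 0)

end AEDistortion

section LpConvergence

variable {X F : Type*} [MeasurableSpace X] [NormedAddCommGroup F] {μ : Measure X}

lemma tendsto_eLpNorm_of_tendstoUniformly {f : ℕ → X → F} {f' : X → F}
    (h : TendstoUniformly f f' atTop) (hμ : μ univ ≠ ⊤) (p : ℝ≥0∞) :
    Tendsto (fun m => eLpNorm (f m - f') p μ) atTop (𝓝 0) := by
  have hlim : Tendsto (fun r => μ univ ^ p.toReal⁻¹ * ENNReal.ofReal r) (𝓝[>] 0) (𝓝 0) := by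
    have hofReal := (ENNReal.continuous_ofReal.tendsto 0).mono_left
      (nhdsWithin_le_nhds (s := Ioi 0))
    rw [ENNReal.ofReal_zero] at hofReal
    simpa using ENNReal.Tendsto.const_mul hofReal
      (.inr (ENNReal.rpow_ne_top_of_nonneg (by positivity) hμ))
  refine ENNReal.tendsto_nhds_zero.2 fun ε hε => ?_
  obtain ⟨r, hr, hr0⟩ := ((ENNReal.tendsto_nhds_zero.1 hlim ε hε).and self_mem_nhdsWithin).exists
  filter_upwards [Metric.tendstoUniformly_iff.1 h r hr0] with m hm
  refine (eLpNorm_le_of_ae_bound (.of_forall fun z => ?_)).trans hr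
  rw [Pi.sub_apply, ← dist_eq_norm, dist_comm]
  exact (hm z).le

lemma tendsto_eLpNorm_one_of_support_subset {p V : ℝ≥0∞} (hp : 1 < p) (hV : V ≠ ⊤) {g : ℕ → X → F}
    {S : ℕ → Set X} (hg : ∀ m, AEStronglyMeasurable (g m) μ) (hgV : ∀ m, eLpNorm (g m) p μ ≤ V)
    (hgS : ∀ m, Function.support (g m) ⊆ S m)
    (hS : Tendsto (fun m => μ (S m)) atTop (𝓝 0)) :
    Tendsto (fun m => eLpNorm (g m) 1 μ) atTop (𝓝 0) := by
  set q : ℝ := 1 - 1 / p.toReal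
  have hq : 0 < q := by
    have : 1 / p.toReal < 1 := by
      rcases eq_or_ne p ⊤ with rfl | hpt
      · simp
      · rw [one_div]
        exact inv_lt_one_of_one_lt₀ (by simpa using ENNReal.toReal_strict_mono hpt hp)
    simpa [q] using this
  have hlim : Tendsto (fun m => V * μ (S m) ^ q) atTop (𝓝 0) := by
    have := ((ENNReal.continuous_rpow_const (y := q)).tendsto 0).comp hS
    rw [ENNReal.zero_rpow_of_pos hq] at this
    simpa using ENNReal.Tendsto.const_mul this (.inr hV)
  refine tendsto_of_tendsto_of_tendsto_of_le_of_le tendsto_const_nhds hlim (fun _ => zero_le)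
    fun m => ?_
  rw [← eLpNorm_restrict_eq_of_support_subset (hgS m)]
  calc eLpNorm (g m) 1 (μ.restrict (S m))
      ≤ eLpNorm (g m) p (μ.restrict (S m)) * μ (S m) ^ q := by
        simpa [q] using eLpNorm_le_eLpNorm_mul_rpow_measure_univ hp.le (hg m).restrict
    _ ≤ V * μ (S m) ^ q := by
        gcongr
        exact (eLpNorm_restrict_le _ _ _ _).trans (hgV m)

variable [NormedSpace ℝ F] [TopologicalSpace X] [OpensMeasurableSpace X] [T2Space X]

lemma tendsto_integral_smul_of_tendsto_eLpNorm {φ : X → ℝ} (hφ : Continuous φ)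
    (hφc : HasCompactSupport φ) {g : ℕ → X → F} {g' : X → F}
    (hg : ∀ m, LocallyIntegrable (g m) μ) (hg' : LocallyIntegrable g' μ)
    (h : ∀ C, IsCompact C → Tendsto (fun m => eLpNorm (g m - g') 1 (μ.restrict C)) atTop (𝓝 0)) :
    Tendsto (fun m => ∫ z, φ z • g m z ∂μ) atTop (𝓝 (∫ z, φ z • g' z ∂μ)) := by
  obtain ⟨M, hM⟩ := hφc.exists_bound_of_continuous hφ
  refine tendsto_integral_of_L1' _
    (hg'.integrable_smul_left_of_hasCompactSupport hφ hφc).aestronglyMeasurable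
    (.of_forall fun m => (hg m).integrable_smul_left_of_hasCompactSupport hφ hφc) ?_
  have hlim := ENNReal.Tendsto.const_mul (h _ hφc) (.inr (ENNReal.ofReal_ne_top (r := M)))
  rw [mul_zero] at hlim
  refine tendsto_of_tendsto_of_tendsto_of_le_of_le tendsto_const_nhds hlim (fun _ => zero_le)
    fun m => ?_
  have hsupp : Function.support ((fun z => φ z • g m z) - fun z => φ z • g' z) ⊆ tsupport φ := by
    refine fun z hz => subset_tsupport φ fun hφz => hz ?_
    simp [hφz]
  rw [← eLpNorm_restrict_eq_of_support_subset hsupp]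
  refine eLpNorm_le_mul_eLpNorm_of_ae_le_mul (.of_forall fun z => ?_) 1
  rw [Pi.sub_apply, Pi.sub_apply, ← smul_sub, norm_smul]
  exact mul_le_mul_of_nonneg_right (hM z) (norm_nonneg _)

end LpConvergence

section WeakDerivative

variable {E F : Type*} [NormedAddCommGroup E] [NormedSpace ℝ E] [NormedAddCommGroup F]
  [NormedSpace ℝ F] [MeasurableSpace E] [BorelSpace E] {μ : Measure E}

lemma integrable_smul_fderiv_of_lipschitz [FiniteDimensional ℝ E] [IsFiniteMeasureOnCompacts μ]
    [FiniteDimensional ℝ F] {C : ℝ≥0} {f : E → F} (hf : LipschitzWith C f) {η : E → ℝ}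
    (hη : Continuous η) (hηc : HasCompactSupport η) (v : E) :
    Integrable (fun z => η z • fderiv ℝ f z v) μ := by
  have hbound : Integrable (fun z => ‖η z‖ * (C * ‖v‖)) μ :=
    (hη.norm.integrable_of_hasCompactSupport hηc.norm).mul_const _
  borelize F
  refine hbound.mono' (hη.aestronglyMeasurable.smul
    (measurable_fderiv_apply_const ℝ f v).aestronglyMeasurable) (.of_forall fun z => ?_)
  rw [norm_smul]
  gcongr
  exact (fderiv ℝ f z).le_of_opNorm_le (norm_fderiv_le_of_lipschitz ℝ hf) v

lemma integral_fderiv_smul_eq_neg_of_lipschitz [FiniteDimensional ℝ E] [μ.IsAddHaarMeasure]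
    [FiniteDimensional ℝ F] {C : ℝ≥0} {f : E → F} (hf : LipschitzWith C f) {η : E → ℝ}
    (hη : ContDiff ℝ 1 η) (hηc : HasCompactSupport η) (v : E) :
    ∫ z, fderiv ℝ η z v • f z ∂μ = -∫ z, η z • fderiv ℝ f z v ∂μ := by
  obtain ⟨D, hD⟩ := hη.lipschitzWith_of_hasCompactSupport hηc one_ne_zero
  have hleft : Integrable (fun z => fderiv ℝ η z v • f z) μ :=
    (((hη.continuous_fderiv one_ne_zero).clm_apply continuous_const).smul
      hf.continuous).integrable_of_hasCompactSupport (hηc.fderiv_apply ℝ v).smul_right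
  have hright := integrable_smul_fderiv_of_lipschitz (μ := μ) hf hη.continuous hηc v
  have := FiniteDimensional.complete ℝ F
  refine SeparatingDual.eq_iff_forall_dual_eq (R := ℝ).2 fun L => ?_
  rw [map_neg, ← L.integral_comp_comm hleft, ← L.integral_comp_comm hright]
  have hae : ∀ᵐ z ∂μ, lineDeriv ℝ (L ∘ f) z v * η z = L (η z • fderiv ℝ f z v) := by
    filter_upwards [hf.ae_differentiableAt (μ := μ)] with z hz
    rw [((L.hasFDerivAt.comp z hz.hasFDerivAt).hasLineDerivAt v).lineDeriv, map_smul,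
      smul_eq_mul, mul_comm]
    rfl
  rw [← integral_congr_ae hae, (L.lipschitz.comp hf).integral_lineDeriv_mul_eq hD hηc v,
    ← integral_neg]
  refine integral_congr_ae (.of_forall fun z => ?_)
  have hη' := (hη.differentiable one_ne_zero z).lineDeriv_eq_fderiv (v := -v)
  simp only [hη', map_neg, map_smul, smul_eq_mul, Function.comp_apply, neg_mul, neg_neg]

lemma hasWeakDerivative_fderiv_of_lipschitz {C : ℝ≥0} {f : ℂ → ℂ} (hf : LipschitzWith C f) :
    HasWeakDerivative f (fderiv ℝ f) := fun _ hη hηc v =>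
  integral_fderiv_smul_eq_neg_of_lipschitz hf (hη.of_le (by simp)) hηc v

lemma hasWeakDerivative_of_tendsto {f : ℕ → ℂ → ℂ} {f' : ℂ → ℂ} {G : ℕ → ℂ → ℂ →L[ℝ] ℂ}
    {G' : ℂ → ℂ →L[ℝ] ℂ} (hfG : ∀ m, HasWeakDerivative (f m) (G m))
    (hf : ∀ m, Continuous (f m)) (hff' : TendstoUniformly f f' atTop)
    (hG : ∀ m, LocallyIntegrable (G m)) (hG' : LocallyIntegrable G')
    (hGG' : ∀ C, IsCompact C →
      Tendsto (fun m => eLpNorm (G m - G') 1 (volume.restrict C)) atTop (𝓝 0)) :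
    HasWeakDerivative f' G' := by
  intro η hη hηc v
  have happly {H : ℂ → ℂ →L[ℝ] ℂ} (hH : LocallyIntegrable H) :
      LocallyIntegrable fun z => H z v := locallyIntegrable_iff.2 fun C hC =>
    (ContinuousLinearMap.apply ℝ ℂ v).integrable_comp (locallyIntegrable_iff.1 hH C hC).integrable
  have hGv {C : Set ℂ} (hC : IsCompact C) :
      Tendsto (fun m => eLpNorm ((fun z => G m z v) - fun z => G' z v) 1 (volume.restrict C)) atTop
        (𝓝 0) := by
    have hlim := ENNReal.Tendsto.const_mul (hGG' C hC)
      (.inr (ENNReal.ofReal_ne_top (r := norm v)))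
    rw [mul_zero] at hlim
    refine tendsto_of_tendsto_of_tendsto_of_le_of_le tendsto_const_nhds hlim (fun _ => zero_le)
      fun m => eLpNorm_le_mul_eLpNorm_of_ae_le_mul (.of_forall fun z => ?_) 1
    rw [mul_comm]
    exact (G m z - G' z).le_opNorm v
  have hright := tendsto_integral_smul_of_tendsto_eLpNorm hη.continuous hηc
    (fun m => happly (hG m)) (happly hG') fun C hC => hGv hC
  have hf' : Continuous f' := hff'.continuous (.of_forall hf)
  have hleft := tendsto_integral_smul_of_tendsto_eLpNorm
    ((hη.continuous_fderiv (by simp)).clm_apply continuous_const) (hηc.fderiv_apply ℝ v)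
    (fun m => (hf m).locallyIntegrable (μ := volume)) hf'.locallyIntegrable
    fun C hC => tendsto_eLpNorm_of_tendstoUniformly hff' (by simpa using hC.measure_lt_top.ne) 1
  exact tendsto_nhds_unique hleft (hright.neg.congr fun m => (hfG m η hη hηc v).symm)

end WeakDerivative

section Energy

variable {E : Type*} [NormedAddCommGroup E] [NormedSpace ℝ E] [FiniteDimensional ℝ E]
  [MeasurableSpace E] [BorelSpace E] {μ : Measure E} [μ.IsAddHaarMeasure] {f : E → E} {K : ℝ}

lemma lintegral_enorm_fderiv_pow_le (hK : 0 ≤ K) (hf : Function.Injective f)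
    (hD : ∀ᵐ z ∂μ, HasDistortionAt K f z) {S : Set E} (hS : MeasurableSet S) :
    ∫⁻ z in S, ‖fderiv ℝ f z‖ₑ ^ finrank ℝ E ∂μ ≤
      ENNReal.ofReal (K ^ finrank ℝ E) * μ (f '' S) := by
  set D := {z | DifferentiableAt ℝ f z}
  have hDm : MeasurableSet D := measurableSet_of_differentiableAt ℝ f
  have hcongr : S =ᵐ[μ] (S ∩ D : Set E) := by
    filter_upwards [hD] with z ⟨A, hA, _⟩
    exact propext ⟨fun h => ⟨h, hA.differentiableAt⟩, fun h => h.1⟩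
  rw [setLIntegral_congr hcongr]
  calc ∫⁻ z in S ∩ D, ‖fderiv ℝ f z‖ₑ ^ finrank ℝ E ∂μ
      ≤ ∫⁻ z in S ∩ D,
          ENNReal.ofReal (K ^ finrank ℝ E) * ENNReal.ofReal |(fderiv ℝ f z).det| ∂μ := by
        refine lintegral_mono_ae (ae_restrict_of_ae ?_)
        filter_upwards [hD] with z ⟨A, hA, hAK⟩
        rw [hA.fderiv, ← ofReal_norm, ← ENNReal.ofReal_pow (norm_nonneg _),
          ← ENNReal.ofReal_mul (by positivity)]
        exact ENNReal.ofReal_le_ofReal (hAK.norm_pow_finrank_le hK)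
    _ = ENNReal.ofReal (K ^ finrank ℝ E) * μ (f '' (S ∩ D)) := by
        rw [lintegral_const_mul' _ _ ENNReal.ofReal_ne_top,
          lintegral_abs_det_fderiv_eq_addHaar_image μ (hS.inter hDm)
            (fun z hz => hz.2.hasFDerivAt.hasFDerivWithinAt) hf.injOn]
    _ ≤ ENNReal.ofReal (K ^ finrank ℝ E) * μ (f '' S) := by
        gcongr
        exact inter_subset_left

lemma eLpNorm_fderiv_le [Nontrivial E] (hK : 0 ≤ K) (hf : Function.Injective f)
    (hD : ∀ᵐ z ∂μ, HasDistortionAt K f z) {S : Set E} (hS : MeasurableSet S) :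
    eLpNorm (fderiv ℝ f) (finrank ℝ E) (μ.restrict S) ≤
      (ENNReal.ofReal (K ^ finrank ℝ E) * μ (f '' S)) ^ (1 / (finrank ℝ E : ℝ)) := by
  have hd : (finrank ℝ E : ℝ≥0∞) ≠ 0 := by simp [finrank_pos.ne']
  rw [eLpNorm_eq_lintegral_rpow_enorm_toReal hd (ENNReal.natCast_ne_top _)]
  simp only [ENNReal.toReal_natCast, ENNReal.rpow_natCast]
  gcongr
  exact lintegral_enorm_fderiv_pow_le hK hf hD hS

lemma memLp_fderiv [Nontrivial E] (hK : 0 ≤ K) (hf : Function.Injective f)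
    (hD : ∀ᵐ z ∂μ, HasDistortionAt K f z) {S : Set E} (hS : MeasurableSet S)
    (hfS : μ (f '' S) ≠ ⊤) : MemLp (fderiv ℝ f) (finrank ℝ E) (μ.restrict S) :=
  ⟨(measurable_fderiv ℝ f).aestronglyMeasurable, (eLpNorm_fderiv_le hK hf hD hS).trans_lt
    (ENNReal.rpow_lt_top_of_nonneg (by positivity) (ENNReal.mul_ne_top ENNReal.ofReal_ne_top hfS))⟩

lemma memLp_fderiv_of_isCompact [Nontrivial E] (hK : 0 ≤ K) (hfc : Continuous f)
    (hf : Function.Injective f) (hD : ∀ᵐ z ∂μ, HasDistortionAt K f z) {C : Set E}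
    (hC : IsCompact C) : MemLp (fderiv ℝ f) (finrank ℝ E) (μ.restrict C) :=
  memLp_fderiv hK hf hD hC.measurableSet (hC.image hfc).measure_lt_top.ne

lemma locallyIntegrable_fderiv [Nontrivial E] (hK : 0 ≤ K) (hfc : Continuous f)
    (hf : Function.Injective f) (hD : ∀ᵐ z ∂μ, HasDistortionAt K f z) :
    LocallyIntegrable (fderiv ℝ f) μ := locallyIntegrable_iff.2 fun C hC => by
  have : IsFiniteMeasure (μ.restrict C) := isFiniteMeasure_restrict.2 hC.measure_lt_top.ne
  exact (memLp_fderiv_of_isCompact hK hfc hf hD hC).integrable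
    (by exact_mod_cast Nat.one_le_iff_ne_zero.2 finrank_pos.ne')

lemma tendsto_eLpNorm_fderiv_sub (hE : 1 < finrank ℝ E) (hK : 0 ≤ K) {f : ℕ → E → E} {F : E → E}
    (hf : ∀ m, Function.Injective (f m)) (hfD : ∀ m, ∀ᵐ z ∂μ, HasDistortionAt K (f m) z)
    (hF : Function.Injective F) (hFD : ∀ᵐ z ∂μ, HasDistortionAt K F z) {S : ℕ → Set E}
    (hS : ∀ m, IsClosed (S m)) (hS0 : Tendsto (fun m => μ (S m)) atTop (𝓝 0))
    (hfS : ∀ m, ∀ z ∉ S m, F z = f m z) {B V : Set E} (hB : MeasurableSet B) (hV : μ V ≠ ⊤)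
    (hfV : ∀ m, f m '' B ⊆ V) (hFV : F '' B ⊆ V) :
    Tendsto (fun m => eLpNorm (fderiv ℝ (f m) - fderiv ℝ F) 1 (μ.restrict B)) atTop (𝓝 0) := by
  have := Module.nontrivial_of_finrank_pos (zero_lt_one.trans hE)
  set c := (ENNReal.ofReal (K ^ finrank ℝ E) * μ V) ^ (1 / (finrank ℝ E : ℝ))
  have hc : c ≠ ⊤ := ENNReal.rpow_ne_top_of_nonneg (by positivity)
    (ENNReal.mul_ne_top ENNReal.ofReal_ne_top hV)
  have henergy {g : E → E} (hg : Function.Injective g) (hgD : ∀ᵐ z ∂μ, HasDistortionAt K g z)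
      (hgV : g '' B ⊆ V) : eLpNorm (fderiv ℝ g) (finrank ℝ E) (μ.restrict B) ≤ c :=
    (eLpNorm_fderiv_le hK hg hgD hB).trans (by unfold c; gcongr)
  have hmeas (g : E → E) : AEStronglyMeasurable (fderiv ℝ g) (μ.restrict B) :=
    (measurable_fderiv ℝ g).aestronglyMeasurable
  refine tendsto_eLpNorm_one_of_support_subset (p := finrank ℝ E) (S := S) (by exact_mod_cast hE)
    (ENNReal.add_ne_top.2 ⟨hc, hc⟩) (fun m => (hmeas _).sub (hmeas _))
    (fun m => (eLpNorm_sub_le (hmeas _) (hmeas _) (by exact_mod_cast hE.le)).trans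
      (add_le_add (henergy (hf m) (hfD m) (hfV m)) (henergy hF hFD hFV))) ?_ ?_
  · intro m z hz
    by_contra hzS
    have heq : F =ᶠ[𝓝 z] f m := by
      filter_upwards [(hS m).isOpen_compl.mem_nhds hzS] with w hw using hfS m w hw
    exact hz (by simp [heq.fderiv_eq])
  · exact tendsto_of_tendsto_of_tendsto_of_le_of_le tendsto_const_nhds hS0 (fun _ => zero_le)
      fun m => Measure.restrict_apply_le _ _

end Energy

section SobolevLimit

lemma IsBallMap.image_closedBall_subset {E : Type*} [NormedAddCommGroup E] {f : E → E}
    (hf : IsBallMap f) {R : ℝ} (hR : 1 ≤ R) : f '' closedBall 0 R ⊆ closedBall 0 R := by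
  rintro _ ⟨z, hz, rfl⟩
  rw [mem_closedBall_zero_iff] at hz ⊢
  rcases le_total ‖z‖ 1 with h | h
  · exact (hf.norm_le z h).trans hR
  · rwa [hf.eq_self z h]

theorem isSobolevLocWith_of_tendstoUniformly {K : ℝ} (hK : 0 ≤ K) {f : ℕ → ℂ → ℂ} {F : ℂ → ℂ}
    (hf : ∀ m, IsBallMap (f m)) (hfi : ∀ m, Function.Injective (f m))
    (hfD : ∀ m, ∀ᵐ z, HasDistortionAt K (f m) z) (hFi : Function.Injective F)
    (hFD : ∀ᵐ z, HasDistortionAt K F z) (hfF : TendstoUniformly f F atTop) {S : ℕ → Set ℂ}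
    (hS : ∀ m, IsClosed (S m)) (hS0 : Tendsto (fun m => volume (S m)) atTop (𝓝 0))
    (hfS : ∀ m, ∀ z ∉ S m, F z = f m z) : IsSobolevLocWith F (fderiv ℝ F) := by
  have hFc : Continuous F := hfF.continuous (.of_forall fun m => (hf m).continuous)
  refine ⟨fun C hC => ?_, fun C hC => ?_, hasWeakDerivative_of_tendsto
    (fun m => (hf m).lipschitz.elim fun _ h => hasWeakDerivative_fderiv_of_lipschitz h)
    (fun m => (hf m).continuous) hfF
    (fun m => locallyIntegrable_fderiv hK (hf m).continuous (hfi m) (hfD m))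
    (locallyIntegrable_fderiv hK hFc hFi hFD) fun C hC => ?_⟩
  · obtain ⟨B, hB⟩ := hC.exists_bound_of_continuousOn hFc.continuousOn
    have : IsFiniteMeasure (volume.restrict C) := isFiniteMeasure_restrict.2 hC.measure_lt_top.ne
    exact MemLp.of_bound hFc.aestronglyMeasurable B
      ((ae_restrict_iff' hC.measurableSet).2 (.of_forall hB))
  · simpa [Complex.finrank_real_complex] using memLp_fderiv_of_isCompact hK hFc hFi hFD hC
  · obtain ⟨r, hr⟩ := hC.isBounded.subset_closedBall 0
    have hCR : C ⊆ closedBall 0 (max 1 r) :=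
      hr.trans (closedBall_subset_closedBall (le_max_right _ _))
    have hfR (m : ℕ) : f m '' C ⊆ closedBall 0 (max 1 r) :=
      (image_mono hCR).trans ((hf m).image_closedBall_subset (le_max_left _ _))
    refine tendsto_eLpNorm_fderiv_sub (by simp [Complex.finrank_real_complex]) hK hfi hfD hFi hFD
      hS hS0 hfS hC.measurableSet measure_closedBall_lt_top.ne hfR ?_
    rintro _ ⟨z, hz, rfl⟩
    exact isClosed_closedBall.mem_of_tendsto (hfF.tendsto_at z)
      (.of_forall fun m => hfR m (mem_image_of_mem _ hz))

end SobolevLimit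

section PackingSequence

variable {E : Type*} [NormedAddCommGroup E] {α β δ : ℝ}

lemma BallPacking.fine_of_radius_le {P : BallPacking E} (hα : 0 < α)
    (h : ∀ i, P.radius i ≤ (1 / 2) ^ α⁻¹) : P.Fine α := fun i =>
  calc P.radius i ^ α ≤ ((1 / 2 : ℝ) ^ α⁻¹) ^ α :=
        Real.rpow_le_rpow (P.radius_pos i).le (h i) hα.le
    _ = 1 / 2 := Real.rpow_inv_rpow (by norm_num) hα.ne'

lemma half_le_prod_of_div_le {m u : ℕ → ℝ} (hu0 : u 0 = 1) (hu : ∀ n, 1 / 2 ≤ u n)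
    (hm : ∀ n, u (n + 1) / u n ≤ m n) (n : ℕ) : 1 / 2 ≤ ∏ k ∈ Finset.range n, m k := by
  have hpos (k : ℕ) : 0 < u k := one_half_pos.trans_le (hu k)
  calc 1 / 2 ≤ u n / u 0 := by rw [hu0, div_one]; exact hu n
    _ = ∏ k ∈ Finset.range n, u (k + 1) / u k := by
        induction n with
        | zero => simp [hu0]
        | succ n ih => rw [Finset.prod_range_succ, ← ih]; field_simp [(hpos n).ne', (hpos 0).ne']
    _ ≤ ∏ k ∈ Finset.range n, m k :=
        Finset.prod_le_prod (fun k _ => (div_pos (hpos _) (hpos k)).le) fun k _ => hm k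

lemma exists_seq_fine_half_le_prod_mass [NormedSpace ℝ E] [FiniteDimensional ℝ E] (hα : 0 < α)
    (hβ : 0 < β) : ∃ P : ℕ → BallPacking E, (∀ n, (P n).Fine α) ∧ (∀ n, (P n).Fine β) ∧
      ∀ n, 1 / 2 ≤ ∏ k ∈ Finset.range n, (P k).mass := by
  let u : ℕ → ℝ := fun n => 1 / 2 + (1 / 2) ^ (n + 1)
  have hu (n : ℕ) : 1 / 2 ≤ u n := le_add_of_nonneg_right (by positivity)
  have hratio (n : ℕ) : u (n + 1) / u n < 1 := by
    rw [div_lt_one (one_half_pos.trans_le (hu n))]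
    exact add_lt_add_right (pow_lt_pow_right_of_lt_one₀ (by norm_num) (by norm_num)
      (Nat.lt_succ_self _)) _
  have hδ : (0 : ℝ) < min ((1 / 2) ^ α⁻¹) ((1 / 2) ^ β⁻¹) :=
    lt_min (by positivity) (by positivity)
  choose P hmass hradius using fun n => BallPacking.exists_mass_ge E (hratio n) hδ
  exact ⟨P,
    fun n => BallPacking.fine_of_radius_le hα fun i => (hradius n i).trans (min_le_left _ _),
    fun n => BallPacking.fine_of_radius_le hβ fun i => (hradius n i).trans (min_le_right _ _),
    half_le_prod_of_div_le (by norm_num [u]) hu hmass⟩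

end PackingSequence

section Quasiconformal

variable {α β : ℝ}

lemma ae_hasDistortionAt_of_tendsto_approx {E : Type*} [NormedAddCommGroup E]
    [InnerProductSpace ℝ E] [FiniteDimensional ℝ E] [Nontrivial E] [MeasurableSpace E]
    [BorelSpace E] {μ : Measure E} [μ.IsAddHaarMeasure] (hβ : 0 < β) (hβα : β ≤ α)
    {P : ℕ → BallPacking E} (hPα : ∀ n, (P n).Fine α) {F : E → E}
    (hF : ∀ z, Tendsto (fun m => approx α β m P z) atTop (𝓝 (F z))) :
    ∀ᵐ z ∂μ, HasDistortionAt (α / β) F z := by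
  have hnull : μ (⋂ m, generation α m P) = 0 :=
    le_antisymm (ge_of_tendsto' (tendsto_measure_generation μ hPα)
      fun m => measure_mono (iInter_subset _ m)) zero_le
  filter_upwards [ae_all_iff.2 fun m => ae_hasDistortionAt_approx hβ hβα m P,
    compl_mem_ae_iff.2 hnull] with z hz hzP
  obtain ⟨m, hm⟩ := by simpa using hzP
  refine (hz m).congr ?_
  filter_upwards [(isCompact_generation m P).isClosed.isOpen_compl.mem_nhds hm] with w hw
  exact eq_approx_of_notMem_generation (hβ.trans_le hβα) hβ (hF w) hw

theorem isQuasiconformal_of_tendstoUniformly_approx (hβ : 0 < β) (hβα : β ≤ α)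
    {P : ℕ → BallPacking ℂ} (hPα : ∀ n, (P n).Fine α) {F : ℂ → ℂ}
    (hF : TendstoUniformly (fun m => approx α β m P) F atTop) : IsQuasiconformal (α / β) F := by
  have hα : 0 < α := hβ.trans_le hβα
  have hFh : IsHomeomorph F := isHomeomorph_of_tendstoUniformly_approx hα hβ hPα hF
  have hD : ∀ᵐ z, HasDistortionAt (α / β) F z :=
    ae_hasDistortionAt_of_tendsto_approx hβ hβα hPα hF.tendsto_at
  refine ⟨hFh, isOrientationPreserving_of_eventuallyEq_id hFh.continuous hFh.injective ?_,
    fderiv ℝ F, isSobolevLocWith_of_tendstoUniformly (by positivity)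
      (fun m => isBallMap_approx hα hβ m)
      (fun m => Function.LeftInverse.injective (approx_inv_approx hα hβ m))
      (fun m => ae_hasDistortionAt_approx hβ hβα m P) hFh.injective hD hF
      (fun m => (isCompact_generation m P).isClosed) (tendsto_measure_generation volume hPα)
      fun m z hz => eq_approx_of_notMem_generation hα hβ (hF.tendsto_at z) hz, ?_⟩
  · filter_upwards [(isCompact_closedBall (0 : ℂ) 1).compl_mem_cocompact] with z hz
    rw [mem_compl_iff, mem_closedBall_zero_iff, not_le] at hz
    exact eq_self_of_tendsto_approx hα hβ (hF.tendsto_at z) hz.le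
  · filter_upwards [hD] with z ⟨A, hA, hAK⟩ a b
    rw [hA.fderiv]
    exact hAK _ _ (by simp only [Complex.norm_exp_ofReal_mul_I])

theorem exists_isQuasiconformal_image_packingCantorSet (hβ : 0 < β) (hβα : β ≤ α)
    {P : ℕ → BallPacking ℂ} (hPα : ∀ n, (P n).Fine α) (hPβ : ∀ n, (P n).Fine β) :
    ∃ F, IsQuasiconformal (α / β) F ∧ F '' packingCantorSet α P = packingCantorSet β P := by
  have hα : 0 < α := hβ.trans_le hβα
  obtain ⟨F, hF⟩ := exists_tendstoUniformly_approx hα hβ hPβ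
  exact ⟨F, isQuasiconformal_of_tendstoUniformly_approx hβ hβα hPα hF,
    image_packingCantorSet_of_tendsto_approx hα hβ hPα hPβ hF.tendsto_at⟩

lemma cantorDim_complex_two_div_sub_one {t : ℝ} : cantorDim ℂ (2 / t - 1) = t := by
  rw [cantorDim, Complex.finrank_real_complex, add_sub_cancel, Nat.cast_ofNat,
    div_div_cancel₀ two_ne_zero]

lemma cantorDim_complex_two_div_sub_one_div {K t : ℝ} (hK : 0 < K) (ht : t ≠ 0) :
    cantorDim ℂ ((2 / t - 1) / K) = 2 * K * t / (2 + (K - 1) * t) := by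
  rw [cantorDim, Complex.finrank_real_complex, Nat.cast_ofNat]
  have : 1 + (2 / t - 1) / K = (2 + (K - 1) * t) / (K * t) := by
    field_simp
    ring
  rw [this, div_div_eq_mul_div, mul_assoc]

end Quasiconformal

theorem theorem2p2 (K : ℝ) (hK : 1 < K) (t : ℝ) (ht0 : 0 < t) (ht2 : t < 2) :
    ∃ (E : Set ℂ) (φ : ℂ → ℂ),
      IsCompact E ∧
      0 < Measure.hausdorffMeasure t E ∧ Measure.hausdorffMeasure t E < ⊤ ∧
      IsQuasiconformal K φ ∧
      0 < Measure.hausdorffMeasure (2 * K * t / (2 + (K - 1) * t)) (φ '' E) ∧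
      Measure.hausdorffMeasure (2 * K * t / (2 + (K - 1) * t)) (φ '' E) < ⊤ := by
  have hK0 : 0 < K := one_pos.trans hK
  set α : ℝ := 2 / t - 1
  have hα : 0 < α := sub_pos.2 ((one_lt_div ht0).2 ht2)
  have hβ : 0 < α / K := div_pos hα hK0
  obtain ⟨P, hPα, hPβ, hmass⟩ := exists_seq_fine_half_le_prod_mass (E := ℂ) hα hβ
  obtain ⟨φ, hφ, himage⟩ := exists_isQuasiconformal_image_packingCantorSet hβ
    (div_le_self hα.le hK.le) hPα hPβ
  rw [div_div_cancel₀ hα.ne'] at hφ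
  have hdimα : cantorDim ℂ α = t := cantorDim_complex_two_div_sub_one
  have hdimβ : cantorDim ℂ (α / K) = 2 * K * t / (2 + (K - 1) * t) :=
    cantorDim_complex_two_div_sub_one_div hK0 ht0.ne'
  have hposα := hausdorffMeasure_packingCantorSet_pos hα hPα one_half_pos hmass
  have hposβ := hausdorffMeasure_packingCantorSet_pos hβ hPβ one_half_pos hmass
  have hfinα := hausdorffMeasure_packingCantorSet_lt_top hα hPα
  have hfinβ := hausdorffMeasure_packingCantorSet_lt_top hβ hPβ
  rw [hdimα] at hposα hfinα
  rw [hdimβ, ← himage] at hposβ hfinβ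
  exact ⟨packingCantorSet α P, φ, isCompact_packingCantorSet hPα, hposα, hfinα, hφ, hposβ, hfinβ⟩
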